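/- Let $n, d$ be non-negative integers. A rank $d$ mold of degree $n$ on a scheme $X$ is a subsheaf of $\mathcal{O}_X$-algebras $\mathcal{A}\subseteq \mathrm{M}_n(\mathcal{O}_X)$ such that $\mathcal{A}$ and $\mathrm{M}_n(\mathcal{O}_X)/\mathcal{A}$ are locally free $\mathcal{O}_X$-modules and $\mathcal{A}$ has rank $d$. Let $\mathrm{Mold}_{n,d}$ be the scheme (over $\mathbb{Z}$) representing the contravariant functor $X\mapsto\{\text{rank } d \text{ molds of degree } n \text{ on } X\}$ on schemes, where morphisms act by pullback of molds. Let $S$ be a locally noetherian scheme and $\mathcal{A}$ a rank $d$ mold of degree $n$ on $S$. For $x\in S$ with residue field $k(x)$ put $\mathcal{A}(x)=\mathcal{A}\otimes_{\mathcal{O}_S}k(x)\subseteq \mathrm{M}_n(k(x))$. Let $\mathrm{PGL}_{n,S}=\mathrm{PGL}_n\otimes_{\mathbb{Z}}S$ and let $$\phi_{\mathcal{A}}:\mathrm{PGL}_{n,S}\longrightarrow \mathrm{Mold}_{n,d}\otimes_{\mathbb{Z}}S,\qquad P\longmapsto P^{-1}\mathcal{A}P,$$ be the morphism of $S$-schemes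 which, for every $S$-scheme $X$ with structure morphism $f$, sends $P\in\mathrm{PGL}_{n,S}(X)$ to the mold $P^{-1}(f^{*}\mathcal{A})P$ on $X$. For an algebra $A$ over a field $k$ and an $A$-bimodule $M$ over $k$, let $H^1(A,M)$ be the first Hochschild cohomology group, i.e. the quotient of the space of $k$-linear maps $f:A\to M$ with $f(ab)=a f(b)+f(a)b$ for all $a,b\in A$ by the subspace of the maps $a\mapsto am-ma$ with $m\in M$. If $H^1\bigl(\mathcal{A}(x),\mathrm{M}_n(k(x))/\mathcal{A}(x)\bigr)=0$ for every $x\in S$, then the $\mathrm{PGL}_{n,S}$-orbit of $\mathcal{A}$, that is, the image of $\phi_{\mathcal{A}}$, is open in $\mathrm{Mold}_{n,d}\otimes_{\mathbb{Z}}S$. -/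

import Mathlib

open CategoryTheory Limits AlgebraicGeometry Opposite TensorProduct

universe u

namespace Moduli

/-- Extension of scalars inside matrix rings: for a ring homomorphism `φ : R → R'` and an
`R`-subalgebra `A ⊆ M_n(R)` this is the image of `R' ⊗_R A → M_n(R')`, that is, the
`R'`-subalgebra of `M_n(R')` generated (equivalently, `R'`-spanned) by the image of `A`. -/
def extend {n : ℕ} {R R' : Type*} [CommRing R] [CommRing R'] (φ : R →+* R')
    (A : Subalgebra R (Matrix (Fin n) (Fin n) R)) : Subalgebra R' (Matrix (Fin n) (Fin n) R') :=
  Algebra.adjoin R' (φ.mapMatrix '' (A : Set (Matrix (Fin n) (Fin n) R)))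

section Algebra

variable {n d : ℕ} {R R' R'' : Type*} [CommRing R] [CommRing R'] [CommRing R'']

lemma mapMatrix_smul (φ : R →+* R') (r : R) (a : Matrix (Fin n) (Fin n) R) :
    φ.mapMatrix (r • a) = φ r • φ.mapMatrix a := by
  ext i j; simp

lemma toSubmodule_extend (φ : R →+* R') (A : Subalgebra R (Matrix (Fin n) (Fin n) R)) :
    Subalgebra.toSubmodule (extend φ A) =
      Submodule.span R' (φ.mapMatrix '' (A : Set (Matrix (Fin n) (Fin n) R))) := by
  rw [extend, Algebra.adjoin_eq_span]
  congr 1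
  have : φ.mapMatrix '' (A : Set (Matrix (Fin n) (Fin n) R)) =
      (A.toSubsemiring.toSubmonoid.map
        ((φ.mapMatrix : Matrix (Fin n) (Fin n) R →+* Matrix (Fin n) (Fin n) R') :
          Matrix (Fin n) (Fin n) R →* Matrix (Fin n) (Fin n) R') :
        Set (Matrix (Fin n) (Fin n) R')) := by
    ext; simp
  rw [this, Submonoid.closure_eq]

lemma toSubmodule_extend_of_span (φ : R →+* R') {A : Subalgebra R (Matrix (Fin n) (Fin n) R)}
    {ι : Type*} {v : ι → Matrix (Fin n) (Fin n) R}
    (h : Subalgebra.toSubmodule A = Submodule.span R (Set.range v)) :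
    Subalgebra.toSubmodule (extend φ A) =
      Submodule.span R' (Set.range fun i => φ.mapMatrix (v i)) := by
  rw [toSubmodule_extend]
  apply le_antisymm
  · rw [Submodule.span_le]
    rintro _ ⟨a, ha, rfl⟩
    have ha' : a ∈ Submodule.span R (Set.range v) := by rw [← h]; exact ha
    induction ha' using Submodule.span_induction with
    | mem x hx => obtain ⟨i, rfl⟩ := hx; exact Submodule.subset_span ⟨i, rfl⟩
    | zero => simp
    | add x y hx hy h1 h2 =>
      rw [map_add]
      have e : ∀ z, z ∈ Submodule.span R (Set.range v) → z ∈ (A : Set _) := fun z hz => by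
        rw [← h] at hz; exact hz
      exact add_mem (h1 (e x hx)) (h2 (e y hy))
    | smul r x hx h1 =>
      have e : x ∈ (A : Set _) := by rw [← h] at hx; exact hx
      rw [mapMatrix_smul]
      exact Submodule.smul_mem _ _ (h1 e)
  · apply Submodule.span_mono
    rintro _ ⟨i, rfl⟩
    refine ⟨v i, ?_, rfl⟩
    have : v i ∈ Subalgebra.toSubmodule A := by rw [h]; exact Submodule.subset_span ⟨i, rfl⟩
    exact this

lemma extend_id (A : Subalgebra R (Matrix (Fin n) (Fin n) R)) :
    extend (RingHom.id R) A = A := by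
  have : ((RingHom.id R).mapMatrix '' (A : Set (Matrix (Fin n) (Fin n) R))) = A := by
    ext; simp
  rw [extend, this, Algebra.adjoin_eq]

lemma extend_comp (φ : R →+* R') (ψ : R' →+* R'') (A : Subalgebra R (Matrix (Fin n) (Fin n) R)) :
    extend (ψ.comp φ) A = extend ψ (extend φ A) := by
  apply Subalgebra.toSubmodule_injective
  have h := toSubmodule_extend φ A
  rw [Set.image_eq_range] at h
  rw [toSubmodule_extend_of_span ψ h, toSubmodule_extend, Set.image_eq_range]
  congr 1

lemma extend_injective_of_leftInverse {φ : R →+* R'} {ψ : R' →+* R} (h : ψ.comp φ = RingHom.id R) :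
    Function.Injective (extend (n := n) φ) := fun A B hAB => by
  rw [← extend_id A, ← extend_id B, ← h, extend_comp, extend_comp, hAB]

/-- The image of a basis of `M_n(R)` under `M_n(R) → M_n(R')` is a basis. -/
noncomputable def mapBasis {ι : Type*} (φ : R →+* R')
    (b : Module.Basis ι R (Matrix (Fin n) (Fin n) R)) :
    Module.Basis ι R' (Matrix (Fin n) (Fin n) R') :=
  letI := φ.toAlgebra
  (Algebra.TensorProduct.basis R' b).map
    { (matrixEquivTensor (Fin n) R R').symm with
      map_smul' := fun r x => by
        change (matrixEquivTensor (Fin n) R R').symm (r • x) =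
          r • (matrixEquivTensor (Fin n) R R').symm x
        induction x using TensorProduct.induction_on with
        | zero => simp
        | tmul a m => simp only [TensorProduct.smul_tmul', matrixEquivTensor_apply_symm, smul_smul,
            smul_eq_mul]
        | add x y hx hy => simp only [smul_add, map_add, hx, hy] }

lemma mapBasis_apply {ι : Type*} (φ : R →+* R')
    (b : Module.Basis ι R (Matrix (Fin n) (Fin n) R)) (i : ι) :
    mapBasis φ b i = φ.mapMatrix (b i) := by
  let _ := φ.toAlgebra
  have h : mapBasis φ b i = (matrixEquivTensor (Fin n) R R').symm (1 ⊗ₜ b i) := by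
    simp [mapBasis]
  rw [h, matrixEquivTensor_apply_symm, one_smul]
  rfl

/-- A sequence `a_1, …, a_d` of matrices is a frame of the subalgebra `A`, normalized at the
`d` matrix positions `σ`: it spans `A` and the `σ k`-entry of `a_i` is `δ_{ik}`. -/
structure IsFrame (σ : Fin d → Fin n × Fin n) (A : Subalgebra R (Matrix (Fin n) (Fin n) R))
    (a : Fin d → Matrix (Fin n) (Fin n) R) : Prop where
  delta : ∀ i k, a i (σ k).1 (σ k).2 = if i = k then 1 else 0
  span : Subalgebra.toSubmodule A = Submodule.span R (Set.range a)

lemma expand_of_mem_span {σ : Fin d → Fin n × Fin n} {a : Fin d → Matrix (Fin n) (Fin n) R}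
    (h : ∀ i k, a i (σ k).1 (σ k).2 = if i = k then 1 else 0)
    {v : Matrix (Fin n) (Fin n) R} (hv : v ∈ Submodule.span R (Set.range a)) :
    v = ∑ i, v (σ i).1 (σ i).2 • a i := by
  rw [Submodule.mem_span_range_iff_exists_fun] at hv
  obtain ⟨c, rfl⟩ := hv
  refine Finset.sum_congr rfl fun k _ => ?_
  congr 1
  simp [Matrix.sum_apply, h]

lemma IsFrame.unique {σ : Fin d → Fin n × Fin n} {A : Subalgebra R (Matrix (Fin n) (Fin n) R)}
    {a a' : Fin d → Matrix (Fin n) (Fin n) R} (h : IsFrame σ A a) (h' : IsFrame σ A a') :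
    a = a' := by
  funext i
  have hi : a i ∈ Submodule.span R (Set.range a') := by
    rw [← h'.span, h.span]; exact Submodule.subset_span ⟨i, rfl⟩
  rw [expand_of_mem_span h'.delta hi]
  simp [h.delta]

lemma IsFrame.extend {σ : Fin d → Fin n × Fin n} {A : Subalgebra R (Matrix (Fin n) (Fin n) R)}
    {a : Fin d → Matrix (Fin n) (Fin n) R} (h : IsFrame σ A a) (φ : R →+* R') :
    IsFrame σ (Moduli.extend φ A) (fun i => φ.mapMatrix (a i)) where
  delta i k := by
    have := congrArg φ (h.delta i k)
    simpa [apply_ite φ] using this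
  span := toSubmodule_extend_of_span φ h.span

/-- If the minor of a spanning sequence at the positions `σ` is invertible, the sequence can be
normalized. -/
lemma exists_isFrame {σ : Fin d → Fin n × Fin n} {A : Subalgebra R (Matrix (Fin n) (Fin n) R)}
    {b : Fin d → Matrix (Fin n) (Fin n) R}
    (hb : Subalgebra.toSubmodule A = Submodule.span R (Set.range b))
    (hu : IsUnit (Matrix.det (Matrix.of fun i k : Fin d => b i (σ k).1 (σ k).2))) :
    IsFrame σ A (fun i => ∑ j, (Matrix.of fun i k : Fin d => b i (σ k).1 (σ k).2)⁻¹ i j • b j) := by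
  set m : Matrix (Fin d) (Fin d) R := Matrix.of fun i k : Fin d => b i (σ k).1 (σ k).2 with hm
  constructor
  · intro i k
    have : (m⁻¹ * m) i k = (1 : Matrix (Fin d) (Fin d) R) i k := by
      rw [Matrix.nonsing_inv_mul _ hu]
    rw [Matrix.one_apply] at this
    rw [← this]
    simp [Matrix.mul_apply, Matrix.sum_apply, hm]
  · rw [hb]
    apply le_antisymm
    · rw [Submodule.span_le]
      rintro _ ⟨i, rfl⟩
      have : b i = ∑ k, m i k • ∑ j, m⁻¹ k j • b j := by
        simp_rw [Finset.smul_sum, smul_smul]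
        rw [Finset.sum_comm]
        simp_rw [← Finset.sum_smul, ← Matrix.mul_apply, Matrix.mul_nonsing_inv _ hu,
          Matrix.one_apply, ite_smul, one_smul, zero_smul]
        simp
      rw [this]
      exact Submodule.sum_mem _ fun k _ => Submodule.smul_mem _ _ (Submodule.subset_span ⟨k, rfl⟩)
    · rw [Submodule.span_le]
      rintro _ ⟨i, rfl⟩
      exact Submodule.sum_mem _ fun k _ => Submodule.smul_mem _ _ (Submodule.subset_span ⟨k, rfl⟩)

/-- Conversely the minor at `σ` is invertible if a normalized frame exists. -/
lemma isUnit_det_of_isFrame {σ : Fin d → Fin n × Fin n}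
    {A : Subalgebra R (Matrix (Fin n) (Fin n) R)} {a b : Fin d → Matrix (Fin n) (Fin n) R}
    (ha : IsFrame σ A a) (hb : Subalgebra.toSubmodule A = Submodule.span R (Set.range b)) :
    IsUnit (Matrix.det (Matrix.of fun i k : Fin d => b i (σ k).1 (σ k).2)) := by
  have h (i : Fin d) : ∃ c : Fin d → R, ∑ j, c j • b j = a i := by
    rw [← Submodule.mem_span_range_iff_exists_fun, ← hb, ha.span]
    exact Submodule.subset_span ⟨i, rfl⟩
  choose c hc using h
  have : Matrix.of c * (Matrix.of fun i k : Fin d => b i (σ k).1 (σ k).2) = 1 := by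
    ext i k
    rw [Matrix.one_apply, ← ha.delta, ← hc]
    simp [Matrix.mul_apply, Matrix.sum_apply]
  exact Matrix.isUnit_det_of_left_inverse this

/-- Over a local ring some maximal minor of a partial basis is invertible. -/
lemma exists_minor [IsLocalRing R] {κ : Type*}
    (b : Module.Basis (Fin d ⊕ κ) R (Matrix (Fin n) (Fin n) R)) :
    ∃ σ : Fin d → Fin n × Fin n,
      IsUnit (Matrix.det (Matrix.of fun i k : Fin d => b (Sum.inl i) (σ k).1 (σ k).2)) := by
  let K := IsLocalRing.ResidueField R
  let b' := mapBasis (IsLocalRing.residue R) b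
  let v : Fin d → (Fin n × Fin n → K) := fun i p => b' (Sum.inl i) p.1 p.2
  let w : Fin n × Fin n → (Fin d → K) := fun p i => b' (Sum.inl i) p.1 p.2
  have hv : LinearIndependent K v := by
    have h1 : LinearIndependent K (fun i : Fin d => b' (Sum.inl i)) :=
      b'.linearIndependent.comp _ Sum.inl_injective
    rw [Fintype.linearIndependent_iff] at h1 ⊢
    intro g hg
    apply h1 g
    ext i j
    have := congrFun hg (i, j)
    simpa [v, Matrix.sum_apply] using this
  have hw : Submodule.span K (Set.range w) = ⊤ := by
    have := hv.rank_matrix (M := Matrix.of v)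
    have h2 := (Matrix.of v).rank_eq_finrank_span_cols
    rw [this, Fintype.card_fin] at h2
    apply Submodule.eq_top_of_finrank_eq
    rw [Module.finrank_fin_fun]
    exact h2.symm
  obtain ⟨f, hf1, hf2, hf3⟩ := Submodule.exists_fun_fin_finrank_span_eq K (Set.range w)
  have hfr : Module.finrank K (Submodule.span K (Set.range w)) = d := by
    exact (congrArg (fun W : Submodule K (Fin d → K) => Module.finrank K W) hw).trans
      (by rw [finrank_top, Module.finrank_fin_fun])
  choose τ hτ using hf1
  refine ⟨fun k => τ (Fin.cast hfr.symm k), ?_⟩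
  rw [← isUnit_map_iff (IsLocalRing.residue R), RingHom.map_det, ← Matrix.isUnit_iff_isUnit_det,
    ← Matrix.linearIndependent_cols_iff_isUnit]
  have h3 := hf3.comp (Fin.cast hfr.symm) (Fin.cast_injective _)
  have e : ((IsLocalRing.residue R).mapMatrix (Matrix.of fun i k : Fin d =>
      b (Sum.inl i) (τ (Fin.cast hfr.symm k)).1 (τ (Fin.cast hfr.symm k)).2)).col =
      f ∘ Fin.cast hfr.symm := by
    funext k i
    rw [Function.comp_apply, ← hτ]
    simp [w, b', mapBasis_apply]
  rw [e]
  exact h3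

/-- A normalized sequence extends to a basis of the whole matrix module. -/
lemma exists_basis_of_delta {σ : Fin d → Fin n × Fin n}
    {a : Fin d → Matrix (Fin n) (Fin n) R}
    (h : ∀ i k, a i (σ k).1 (σ k).2 = if i = k then 1 else 0) :
    ∃ (e : ℕ) (b : Module.Basis (Fin d ⊕ Fin e) R (Matrix (Fin n) (Fin n) R)),
      ∀ i, b (Sum.inl i) = a i := by
  classical
  let κ := {p : Fin n × Fin n // p ∉ Set.range σ}
  let v : Fin d ⊕ κ → Matrix (Fin n) (Fin n) R :=
    Sum.elim a (fun p => Matrix.single p.1.1 p.1.2 1)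
  have hE (p : κ) (k : Fin d) :
      Matrix.single p.1.1 p.1.2 (1 : R) (σ k).1 (σ k).2 = 0 := by
    rw [Matrix.single_apply, if_neg]
    rintro ⟨h1, h2⟩
    exact p.2 ⟨k, (Prod.ext h1 h2).symm⟩
  have hE' (p q : κ) : Matrix.single p.1.1 p.1.2 (1 : R) q.1.1 q.1.2 = if p = q then 1 else 0 := by
    rw [Matrix.single_apply]
    congr 1
    rw [Subtype.ext_iff, Prod.ext_iff]
  have hli : LinearIndependent R v := by
    rw [Fintype.linearIndependent_iff]
    intro g hg
    rw [Fintype.sum_sum_type] at hg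
    simp only [v, Sum.elim_inl, Sum.elim_inr] at hg
    have h1 (k : Fin d) : g (Sum.inl k) = 0 := by
      have := congrFun (congrFun hg (σ k).1) (σ k).2
      simpa [Matrix.sum_apply, h, hE, -Matrix.smul_single] using this
    have h2 (q : κ) : g (Sum.inr q) = 0 := by
      have := congrFun (congrFun hg q.1.1) q.1.2
      simp only [Matrix.add_apply, Matrix.sum_apply, h1, zero_smul, Finset.sum_const_zero,
        zero_add, Matrix.smul_apply, hE', Matrix.zero_apply] at this
      rwa [Finset.sum_eq_single q (fun p _ hp => by rw [if_neg hp, smul_zero])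
        (fun hq => absurd (Finset.mem_univ q) hq), if_pos rfl, smul_eq_mul, mul_one] at this
    rintro (k | q)
    · exact h1 k
    · exact h2 q
  have hsp : ⊤ ≤ Submodule.span R (Set.range v) := by
    intro x _
    rw [Submodule.mem_span_range_iff_exists_fun]
    let y := x - ∑ i, x (σ i).1 (σ i).2 • a i
    refine ⟨Sum.elim (fun i => x (σ i).1 (σ i).2) (fun q => y q.1.1 q.1.2), ?_⟩
    rw [Fintype.sum_sum_type]
    simp only [v, Sum.elim_inl, Sum.elim_inr]
    have : ∑ q : κ, y q.1.1 q.1.2 • Matrix.single q.1.1 q.1.2 (1 : R) = y := by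
      ext i j
      by_cases hij : (i, j) ∈ Set.range σ
      · obtain ⟨k, hk⟩ := hij
        have h1 : i = (σ k).1 := by rw [hk]
        have h2 : j = (σ k).2 := by rw [hk]
        rw [h1, h2]
        simp [Matrix.sum_apply, hE, y, h, -Matrix.smul_single]
      · have := hE' (q := ⟨(i, j), hij⟩)
        simp only at this
        simp only [Matrix.sum_apply, Matrix.smul_apply, this]
        rw [Finset.sum_eq_single (⟨(i, j), hij⟩ : κ) (fun p _ hp => by rw [if_neg hp, smul_zero])
          (fun hq => absurd (Finset.mem_univ _) hq), if_pos rfl, smul_eq_mul, mul_one]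
    rw [this]
    simp [y]
  let eκ := Fintype.equivFin κ
  refine ⟨Fintype.card κ, (Module.Basis.mk hli hsp).reindex (Equiv.sumCongr (Equiv.refl _) eκ), ?_⟩
  intro i
  simp [v]

end Algebra

/-- A mold of degree `n` and rank `d` on a scheme `X`: a subsheaf of `𝒪_X`-algebras
`𝒜 ⊆ M_n(𝒪_X)` such that `𝒜` is locally free of rank `d` and `M_n(𝒪_X)/𝒜` is locally free.

The subsheaf is recorded by its stalks `𝒜_x ⊆ M_n(𝒪_{X,x})`; its sections over an open `U` are the
matrices over `Γ(X, U)` all of whose germs lie in the stalks of `𝒜`. The local freeness of `𝒜` (with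
rank `d`) and of the quotient says that, locally on `X`, some basis of the free module `M_n(𝒪_X)`
has the property that its first `d` members span `𝒜`. -/
@[ext]
structure Mold (n d : ℕ) (X : Scheme.{u}) where
  /-- The stalk of the sheaf of algebras at a point. -/
  stalk (x : X) : Subalgebra (X.presheaf.stalk x) (Matrix (Fin n) (Fin n) (X.presheaf.stalk x))
  locally_free (x : X) : ∃ (U : X.Opens) (_ : x ∈ U) (e : ℕ)
    (b : Module.Basis (Fin d ⊕ Fin e) Γ(X, U) (Matrix (Fin n) (Fin n) Γ(X, U))),
    ∀ (y : X) (hy : y ∈ U), Subalgebra.toSubmodule (stalk y) =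
      Submodule.span (X.presheaf.stalk y)
        (Set.range fun i : Fin d => (X.presheaf.germ U y hy).hom.mapMatrix (b (Sum.inl i)))

namespace Mold

variable {n d : ℕ}

/-- The pullback `f^*𝒜 ⊆ M_n(𝒪_X)` of a mold `𝒜` on `Y` along `f : X ⟶ Y`. -/
noncomputable def pullback {X Y : Scheme.{u}} (f : X ⟶ Y) (A : Mold n d Y) : Mold n d X where
  stalk x := extend (f.stalkMap x).hom (A.stalk (f x))
  locally_free x := by
    obtain ⟨U, hU, e, b, hb⟩ := A.locally_free (f x)
    refine ⟨f ⁻¹ᵁ U, hU, e, mapBasis (f.app U).hom b, fun y hy => ?_⟩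
    rw [toSubmodule_extend_of_span _ (hb (f y) hy)]
    congr 2
    funext i
    rw [mapBasis_apply]
    ext j k
    simp only [RingHom.mapMatrix_apply, Matrix.map_apply]
    exact Scheme.Hom.germ_stalkMap_apply f U y hy _

lemma pullback_id {X : Scheme.{u}} (A : Mold n d X) : A.pullback (𝟙 X) = A := by
  apply Mold.ext
  funext x
  change extend ((𝟙 X : X ⟶ X).stalkMap x).hom (A.stalk x) = A.stalk x
  rw [Scheme.Hom.stalkMap_id]
  exact extend_id _

lemma pullback_comp {X Y Z : Scheme.{u}} (f : X ⟶ Y) (g : Y ⟶ Z) (A : Mold n d Z) :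
    A.pullback (f ≫ g) = (A.pullback g).pullback f := by
  apply Mold.ext
  funext x
  change extend ((f ≫ g).stalkMap x).hom (A.stalk (g (f x))) = _
  rw [Scheme.Hom.stalkMap_comp]
  exact extend_comp _ _ _

/-- The fibre `𝒜(x) = 𝒜 ⊗ k(x) ⊆ M_n(k(x))` of a mold at a point. -/
noncomputable def fiber {X : Scheme.{u}} (A : Mold n d X) (x : X) :
    Subalgebra (X.residueField x) (Matrix (Fin n) (Fin n) (X.residueField x)) :=
  extend (X.residue x).hom (A.stalk x)

end Mold

/-- The contravariant functor `X ↦ {rank d molds of degree n on X}`. -/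
noncomputable def moldFunctor (n d : ℕ) : Scheme.{u}ᵒᵖ ⥤ Type u where
  obj X := Mold n d X.unop
  map f := TypeCat.ofHom (Mold.pullback f.unop)
  map_id X := by
    refine ConcreteCategory.hom_ext _ _ fun A => ?_
    exact Mold.pullback_id A
  map_comp f g := by
    refine ConcreteCategory.hom_ext _ _ fun A => ?_
    exact Mold.pullback_comp g.unop f.unop A

section Charts

variable {n d : ℕ}

/-- The equations saying that `a_1, …, a_d` is normalized at `σ` and spans a subalgebra. -/
def defect {R : Type*} [CommRing R] (σ : Fin d → Fin n × Fin n)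
    (a : Fin d → Matrix (Fin n) (Fin n) R) :
    (Fin d × Fin d) ⊕ (Fin n × Fin n) ⊕ (Fin d × Fin d × Fin n × Fin n) → R
  | Sum.inl (i, k) => a i (σ k).1 (σ k).2 - if i = k then 1 else 0
  | Sum.inr (Sum.inl (p, q)) =>
      (1 : Matrix (Fin n) (Fin n) R) p q -
        ∑ i, (1 : Matrix (Fin n) (Fin n) R) (σ i).1 (σ i).2 * a i p q
  | Sum.inr (Sum.inr (i, j, p, q)) =>
      (a i * a j) p q - ∑ k, (a i * a j) (σ k).1 (σ k).2 * a k p q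

lemma map_defect {R R' : Type*} [CommRing R] [CommRing R'] (φ : R →+* R')
    (σ : Fin d → Fin n × Fin n) (a : Fin d → Matrix (Fin n) (Fin n) R) (x) :
    φ (defect σ a x) = defect σ (fun i => φ.mapMatrix (a i)) x := by
  have h1 (p q : Fin n) : φ ((1 : Matrix (Fin n) (Fin n) R) p q) =
      (1 : Matrix (Fin n) (Fin n) R') p q := by
    simp [Matrix.one_apply, apply_ite φ]
  rcases x with ⟨i, k⟩ | ⟨p, q⟩ | ⟨i, j, p, q⟩
  · simp [defect, apply_ite φ]
  · simp [defect, h1]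
  · simp [defect, Matrix.mul_apply]

section
variable {R : Type*} [CommRing R] {σ : Fin d → Fin n × Fin n}

/-- The subalgebra spanned by a solution of the equations `defect`. -/
def frameAlgebra (a : Fin d → Matrix (Fin n) (Fin n) R) (h : ∀ x, defect σ a x = 0) :
    Subalgebra R (Matrix (Fin n) (Fin n) R) :=
  (Submodule.span R (Set.range a)).toSubalgebra
    (by
      have : (1 : Matrix (Fin n) (Fin n) R) =
          ∑ i, (1 : Matrix (Fin n) (Fin n) R) (σ i).1 (σ i).2 • a i := by
        ext p q
        have := sub_eq_zero.mp (h (Sum.inr (Sum.inl (p, q))))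
        rw [this, Matrix.sum_apply]
        rfl
      rw [this]
      exact Submodule.sum_mem _ fun i _ => Submodule.smul_mem _ _ (Submodule.subset_span ⟨i, rfl⟩))
    (by
      intro x y hx hy
      induction hx, hy using Submodule.span_induction₂ with
      | mem_mem x y hx hy =>
        obtain ⟨i, rfl⟩ := hx
        obtain ⟨j, rfl⟩ := hy
        have : a i * a j = ∑ k, (a i * a j) (σ k).1 (σ k).2 • a k := by
          ext p q
          have := sub_eq_zero.mp (h (Sum.inr (Sum.inr (i, j, p, q))))
          rw [this, Matrix.sum_apply]
          rfl
        rw [this]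
        exact Submodule.sum_mem _ fun i _ =>
          Submodule.smul_mem _ _ (Submodule.subset_span ⟨i, rfl⟩)
      | zero_left y hy => rw [zero_mul]; exact Submodule.zero_mem _
      | zero_right x hx => rw [mul_zero]; exact Submodule.zero_mem _
      | add_left x y z _ _ _ h1 h2 => rw [add_mul]; exact Submodule.add_mem _ h1 h2
      | add_right x y z _ _ _ h1 h2 => rw [mul_add]; exact Submodule.add_mem _ h1 h2
      | smul_left r x y _ _ h1 => rw [smul_mul_assoc]; exact Submodule.smul_mem _ _ h1
      | smul_right r x y _ _ h1 => rw [mul_smul_comm]; exact Submodule.smul_mem _ _ h1)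

lemma delta_of_defect {a : Fin d → Matrix (Fin n) (Fin n) R} (h : ∀ x, defect σ a x = 0) (i k) :
    a i (σ k).1 (σ k).2 = if i = k then 1 else 0 :=
  sub_eq_zero.mp (h (Sum.inl (i, k)))

lemma isFrame_frameAlgebra (a : Fin d → Matrix (Fin n) (Fin n) R) (h : ∀ x, defect σ a x = 0) :
    IsFrame σ (frameAlgebra a h) a where
  delta := delta_of_defect h
  span := Submodule.toSubalgebra_toSubmodule _ _ _

lemma IsFrame.defect_eq_zero {A : Subalgebra R (Matrix (Fin n) (Fin n) R)}
    {a : Fin d → Matrix (Fin n) (Fin n) R} (h : IsFrame σ A a) (x) : defect σ a x = 0 := by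
  have key {v : Matrix (Fin n) (Fin n) R} (hv : v ∈ A) (p q : Fin n) :
      v p q - ∑ i, v (σ i).1 (σ i).2 * a i p q = 0 := by
    have hv' : v ∈ Submodule.span R (Set.range a) := by rw [← h.span]; exact hv
    have := congrFun (congrFun (expand_of_mem_span h.delta hv') p) q
    rw [Matrix.sum_apply] at this
    exact sub_eq_zero.mpr this
  have ha (i : Fin d) : a i ∈ A := by
    have : a i ∈ Subalgebra.toSubmodule A := by rw [h.span]; exact Submodule.subset_span ⟨i, rfl⟩
    exact this
  rcases x with ⟨i, k⟩ | ⟨p, q⟩ | ⟨i, j, p, q⟩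
  · exact sub_eq_zero.mpr (h.delta i k)
  · exact key (one_mem A) p q
  · exact key (mul_mem (ha i) (ha j)) p q

end

/-- The matrices of indeterminates. -/
noncomputable def polyFrame (n d : ℕ) (i : Fin d) : Matrix (Fin n) (Fin n)
    (MvPolynomial (Fin d × Fin n × Fin n) (ULift.{u} ℤ)) :=
  Matrix.of fun p q => MvPolynomial.X (i, p, q)

/-- The coordinate ring of the chart of the moduli of molds at the positions `σ`. -/
def ChartRing (σ : Fin d → Fin n × Fin n) : Type u :=
  MvPolynomial (Fin d × Fin n × Fin n) (ULift.{u} ℤ) ⧸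
    Ideal.span (Set.range (defect σ (polyFrame.{u} n d)))

noncomputable instance (σ : Fin d → Fin n × Fin n) : CommRing (ChartRing.{u} σ) :=
  Ideal.Quotient.commRing (Ideal.span (Set.range (defect σ (polyFrame.{u} n d))))

/-- The projection from the polynomial ring. -/
noncomputable def chartMk (σ : Fin d → Fin n × Fin n) :
    MvPolynomial (Fin d × Fin n × Fin n) (ULift.{u} ℤ) →+* ChartRing.{u} σ :=
  Ideal.Quotient.mk _

/-- The universal normalized frame over the chart. -/
noncomputable def univFrame (σ : Fin d → Fin n × Fin n) (i : Fin d) :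
    Matrix (Fin n) (Fin n) (ChartRing.{u} σ) :=
  (chartMk σ).mapMatrix (polyFrame n d i)

lemma defect_univFrame (σ : Fin d → Fin n × Fin n) (x) : defect σ (univFrame.{u} σ) x = 0 := by
  have h : univFrame.{u} σ = fun i => (chartMk σ).mapMatrix (polyFrame n d i) := rfl
  rw [h, ← map_defect]
  exact Ideal.Quotient.eq_zero_iff_mem.mpr (Ideal.subset_span ⟨x, rfl⟩)

lemma chartRing_hom_ext {R : Type*} [CommRing R] {σ : Fin d → Fin n × Fin n}
    {φ ψ : ChartRing.{u} σ →+* R}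
    (h : ∀ i, φ.mapMatrix (univFrame σ i) = ψ.mapMatrix (univFrame σ i)) : φ = ψ := by
  apply Ideal.Quotient.ringHom_ext
  apply MvPolynomial.ringHom_ext
  · intro r
    obtain ⟨r⟩ := r
    have : (ULift.up r : ULift.{u} ℤ) = (r : ULift.{u} ℤ) := rfl
    rw [this]
    simp
  · rintro ⟨i, p, q⟩
    exact congrFun (congrFun (h i) p) q

lemma exists_chartRing_hom {R : Type*} [CommRing R] {σ : Fin d → Fin n × Fin n}
    (a : Fin d → Matrix (Fin n) (Fin n) R) (h : ∀ x, defect σ a x = 0) :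
    ∃ φ : ChartRing.{u} σ →+* R, ∀ i, φ.mapMatrix (univFrame σ i) = a i := by
  let φ₀ : MvPolynomial (Fin d × Fin n × Fin n) (ULift.{u} ℤ) →+* R :=
    MvPolynomial.eval₂Hom ((Int.castRingHom R).comp (ULift.ringEquiv : ULift.{u} ℤ ≃+* ℤ))
      (fun x => a x.1 x.2.1 x.2.2)
  have h0 (i : Fin d) : φ₀.mapMatrix (polyFrame n d i) = a i := by
    ext p q
    simp [φ₀, polyFrame]
  have hker (r) (hr : r ∈ Ideal.span (Set.range (defect σ (polyFrame.{u} n d)))) : φ₀ r = 0 := by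
    have hle : Ideal.span (Set.range (defect σ (polyFrame.{u} n d))) ≤ RingHom.ker φ₀ := by
      rw [Ideal.span_le]
      rintro _ ⟨x, rfl⟩
      change φ₀ _ = 0
      rw [map_defect]
      simp_rw [h0]
      exact h x
    exact hle hr
  let φ : ChartRing.{u} σ →+* R := Ideal.Quotient.lift _ φ₀ hker
  have hφ (r) : φ (chartMk σ r) = φ₀ r := Ideal.Quotient.lift_mk _ _ _
  refine ⟨φ, fun i => ?_⟩
  rw [← h0]
  ext p q
  simp only [univFrame, RingHom.mapMatrix_apply, Matrix.map_apply, hφ]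

/-- The ring homomorphism `R → Γ(T, ⊤)` attached to a morphism `T ⟶ Spec R`. -/
noncomputable def homOfSpec {T : Scheme.{u}} {R : CommRingCat.{u}} (g : T ⟶ Spec R) :
    R →+* Γ(T, ⊤) :=
  ((Scheme.ΓSpecIso R).inv ≫ g.appTop).hom

lemma homOfSpec_injective {T : Scheme.{u}} {R : CommRingCat.{u}} {g g' : T ⟶ Spec R}
    (h : homOfSpec g = homOfSpec g') : g = g' := by
  apply ext_of_isAffine
  have := CommRingCat.hom_ext h
  rwa [Iso.cancel_iso_inv_left] at this

lemma exists_homOfSpec {T : Scheme.{u}} {R : CommRingCat.{u}} (φ : R →+* Γ(T, ⊤)) :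
    ∃ g : T ⟶ Spec R, homOfSpec g = φ := by
  refine ⟨T.toSpecΓ ≫ Spec.map (CommRingCat.ofHom φ), ?_⟩
  rw [homOfSpec]
  simp

lemma homOfSpec_comp {T T' : Scheme.{u}} {R : CommRingCat.{u}} (f : T' ⟶ T) (g : T ⟶ Spec R) :
    homOfSpec (f ≫ g) = f.appTop.hom.comp (homOfSpec g) := by
  simp [homOfSpec]
  rfl

/-- The germ at `t` of a global section. -/
noncomputable abbrev germTop (T : Scheme.{u}) (t : T) : Γ(T, ⊤) →+* T.presheaf.stalk t :=
  (T.presheaf.germ ⊤ t trivial).hom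

lemma stalkMap_germTop {T T' : Scheme.{u}} (f : T' ⟶ T) (t : T') :
    (f.stalkMap t).hom.comp (germTop T (f t)) = (germTop T' t).comp f.appTop.hom := by
  ext x
  exact Scheme.Hom.germ_stalkMap_apply f ⊤ t trivial x

/-- Global sections with equal germs are equal. -/
lemma eq_of_germTop {T : Scheme.{u}} {x y : Γ(T, ⊤)} (h : ∀ t, germTop T t x = germTop T t y) :
    x = y :=
  TopCat.Presheaf.section_ext T.sheaf ⊤ x y fun t _ => h t

end Charts

section ChartMolds

variable {n d : ℕ} {σ : Fin d → Fin n × Fin n}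

/-- A locally representable family of germs comes from a global section. -/
lemma exists_global {T : Scheme.{u}} (s : ∀ t : T, T.presheaf.stalk t)
    (hs : ∀ t : T, ∃ (V : T.Opens) (_ : t ∈ V) (r : Γ(T, V)), ∀ (y : T) (hy : y ∈ V),
      T.presheaf.germ V y hy r = s y) :
    ∃ r : Γ(T, ⊤), ∀ t, germTop T t r = s t := by
  choose V hV r hr using hs
  obtain ⟨x, hx, -⟩ := T.sheaf.existsUnique_gluing' V ⊤ (fun t => homOfLE le_top)
    (fun t _ => by rw [TopologicalSpace.Opens.mem_iSup]; exact ⟨t, hV t⟩) r (by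
      intro i j
      apply TopCat.Presheaf.section_ext T.sheaf
      intro y hy
      refine (T.presheaf.germ_res_apply _ y hy _).trans ?_
      refine Eq.trans ?_ (T.presheaf.germ_res_apply _ y hy _).symm
      exact (hr i y hy.1).trans (hr j y hy.2).symm)
  refine ⟨x, fun t => ?_⟩
  rw [← hr t t (hV t), ← hx t]
  exact (T.presheaf.germ_res_apply (homOfLE le_top) t (hV t) x).symm

/-- The mold spanned by a normalized frame of global sections. -/
noncomputable def Mold.ofFrame {T : Scheme.{u}} (a : Fin d → Matrix (Fin n) (Fin n) Γ(T, ⊤))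
    (h : ∀ x, defect σ a x = 0) : Mold n d T where
  stalk t := extend (germTop T t) (frameAlgebra a h)
  locally_free t := by
    obtain ⟨e, b, hb⟩ := exists_basis_of_delta (delta_of_defect h)
    refine ⟨⊤, trivial, e, b, fun y hy => ?_⟩
    rw [toSubmodule_extend_of_span _ (isFrame_frameAlgebra a h).span]
    simp_rw [hb]

lemma Mold.isFrame_ofFrame {T : Scheme.{u}} (a : Fin d → Matrix (Fin n) (Fin n) Γ(T, ⊤))
    (h : ∀ x, defect σ a x = 0) (t : T) :
    IsFrame σ ((Mold.ofFrame a h).stalk t) (fun i => (germTop T t).mapMatrix (a i)) :=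
  (isFrame_frameAlgebra a h).extend _

/-- The universal mold on the chart. -/
noncomputable def chartMold (σ : Fin d → Fin n × Fin n) :
    Mold n d (Spec (CommRingCat.of (ChartRing.{u} σ))) :=
  Mold.ofFrame (σ := σ)
    (fun i => (homOfSpec (𝟙 (Spec (CommRingCat.of (ChartRing.{u} σ))))).mapMatrix (univFrame σ i))
    (fun x => by
      rw [← map_defect, defect_univFrame, map_zero])

lemma isFrame_pullback_chartMold {T : Scheme.{u}} (g : T ⟶ Spec (CommRingCat.of (ChartRing.{u} σ)))
    (t : T) : IsFrame σ (((chartMold σ).pullback g).stalk t)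
      (fun i => (germTop T t).mapMatrix ((homOfSpec g).mapMatrix (univFrame σ i))) := by
  have h := (Mold.isFrame_ofFrame (σ := σ) _ (fun x => by
      rw [← map_defect, defect_univFrame, map_zero]) (g t) :
        IsFrame σ ((chartMold.{u} σ).stalk (g t)) _).extend (g.stalkMap t).hom
  have e : (germTop T t).comp (homOfSpec g) = ((g.stalkMap t).hom.comp (germTop _ (g t))).comp
      (homOfSpec (𝟙 _)) := by
    rw [stalkMap_germTop, RingHom.comp_assoc, ← homOfSpec_comp, Category.comp_id]
  convert h using 1
  · rfl
  · funext i
    ext p q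
    exact congrArg (fun φ : ChartRing.{u} σ →+* _ => φ (univFrame σ i p q)) e

lemma chart_hom_ext {T : Scheme.{u}} {g g' : T ⟶ Spec (CommRingCat.of (ChartRing.{u} σ))}
    (h : (chartMold σ).pullback g = (chartMold σ).pullback g') : g = g' := by
  apply homOfSpec_injective
  apply chartRing_hom_ext
  intro i
  ext p q
  apply eq_of_germTop
  intro t
  have h1 := isFrame_pullback_chartMold g t
  rw [h] at h1
  exact congrFun (congrFun (congrFun (h1.unique (isFrame_pullback_chartMold g' t)) i) p) q

/-- Around a point where the mold has a normalized frame, it has a normalized frame of sections. -/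
lemma exists_local_frame {T : Scheme.{u}} (A : Mold n d T) (t : T)
    (h : ∃ a, IsFrame σ (A.stalk t) a) :
    ∃ (V : T.Opens) (_ : t ∈ V) (a : Fin d → Matrix (Fin n) (Fin n) Γ(T, V)),
      ∀ (y : T) (hy : y ∈ V),
        IsFrame σ (A.stalk y) (fun i => (T.presheaf.germ V y hy).hom.mapMatrix (a i)) := by
  obtain ⟨U, hU, e, b, hb⟩ := A.locally_free t
  obtain ⟨a, ha⟩ := h
  let m : Matrix (Fin d) (Fin d) Γ(T, U) :=
    Matrix.of fun i k : Fin d => b (Sum.inl i) (σ k).1 (σ k).2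
  have hdet (y : T) (hy : y ∈ U) : (T.presheaf.germ U y hy).hom m.det = Matrix.det (Matrix.of
      fun i k : Fin d => (T.presheaf.germ U y hy).hom.mapMatrix (b (Sum.inl i)) (σ k).1 (σ k).2) := by
    rw [RingHom.map_det]
    rfl
  have hu := isUnit_det_of_isFrame ha (hb t hU)
  rw [← hdet] at hu
  have htV : t ∈ T.basicOpen m.det := (T.mem_basicOpen m.det t hU).mpr hu
  have hle : T.basicOpen m.det ≤ U := T.basicOpen_le m.det
  let ρ : Γ(T, U) →+* Γ(T, T.basicOpen m.det) := (T.presheaf.map (homOfLE hle).op).hom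
  have hρ (y : T) (hy : y ∈ T.basicOpen m.det) (x : Γ(T, U)) :
      (T.presheaf.germ _ y hy).hom (ρ x) = (T.presheaf.germ U y (hle hy)).hom x :=
    T.presheaf.germ_res_apply (homOfLE hle) y hy x
  let b' : Fin d → Matrix (Fin n) (Fin n) Γ(T, T.basicOpen m.det) :=
    fun i => ρ.mapMatrix (b (Sum.inl i))
  let m' : Matrix (Fin d) (Fin d) Γ(T, T.basicOpen m.det) :=
    Matrix.of fun i k : Fin d => b' i (σ k).1 (σ k).2
  refine ⟨_, htV, fun i => ∑ j, (m'⁻¹) i j • b' j, fun y hy => ?_⟩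
  let γ : Γ(T, T.basicOpen m.det) →+* T.presheaf.stalk y := (T.presheaf.germ _ y hy).hom
  have hm' : IsUnit m'.det := by
    have h1 : m' = ρ.mapMatrix m := rfl
    rw [h1, ← RingHom.map_det]
    exact T.toRingedSpace.isUnit_res_basicOpen m.det
  have hγb (i : Fin d) : γ.mapMatrix (b' i) =
      (T.presheaf.germ U y (hle hy)).hom.mapMatrix (b (Sum.inl i)) := by
    ext p q
    exact hρ y hy _
  have hspan : Subalgebra.toSubmodule (A.stalk y) =
      Submodule.span _ (Set.range fun i => γ.mapMatrix (b' i)) := by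
    rw [hb y (hle hy)]
    simp_rw [hγb]
  let my : Matrix (Fin d) (Fin d) (T.presheaf.stalk y) :=
    Matrix.of fun i k : Fin d => γ.mapMatrix (b' i) (σ k).1 (σ k).2
  have hmy : my = γ.mapMatrix m' := rfl
  have huy : IsUnit my.det := by
    rw [hmy, ← RingHom.map_det]
    exact hm'.map γ
  have hinv : my⁻¹ = γ.mapMatrix m'⁻¹ := by
    apply Matrix.inv_eq_left_inv
    rw [hmy, ← map_mul, Matrix.nonsing_inv_mul _ hm', map_one]
  convert exists_isFrame hspan huy using 1
  funext i
  change γ.mapMatrix _ = ∑ j, my⁻¹ i j • γ.mapMatrix (b' j)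
  rw [map_sum]
  refine Finset.sum_congr rfl fun j _ => ?_
  rw [mapMatrix_smul, hinv]
  rfl

lemma exists_chart_hom {T : Scheme.{u}} (A : Mold n d T)
    (h : ∀ t, ∃ a, IsFrame σ (A.stalk t) a) :
    ∃ g : T ⟶ Spec (CommRingCat.of (ChartRing.{u} σ)), (chartMold σ).pullback g = A := by
  choose a ha using h
  have hloc (i : Fin d) (p q : Fin n) : ∃ r : Γ(T, ⊤), ∀ t, germTop T t r = a t i p q := by
    apply exists_global
    intro t
    obtain ⟨V, hV, c, hc⟩ := exists_local_frame A t ⟨a t, ha t⟩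
    refine ⟨V, hV, c i p q, fun y hy => ?_⟩
    exact congrFun (congrFun (congrFun ((hc y hy).unique (ha y)) i) p) q
  choose r hr using hloc
  let c : Fin d → Matrix (Fin n) (Fin n) Γ(T, ⊤) := fun i => Matrix.of (r i)
  have hc (t : T) : (fun i => (germTop T t).mapMatrix (c i)) = a t := by
    funext i
    ext p q
    exact hr i p q t
  have hdef (x) : defect σ c x = 0 := by
    apply eq_of_germTop
    intro t
    rw [map_defect, hc, (ha t).defect_eq_zero, map_zero]
  obtain ⟨φ, hφ⟩ := exists_chartRing_hom c hdef
  obtain ⟨g, hg⟩ := exists_homOfSpec (R := CommRingCat.of (ChartRing.{u} σ)) φ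
  refine ⟨g, ?_⟩
  apply Mold.ext
  funext t
  apply Subalgebra.toSubmodule_injective
  rw [(isFrame_pullback_chartMold g t).span, (ha t).span, ← hc, hg]
  simp_rw [hφ]

/-- The open locus where a mold has a normalized frame. -/
def frameLocus {T : Scheme.{u}} (σ : Fin d → Fin n × Fin n) (A : Mold n d T) : T.Opens where
  carrier := {t | ∃ a, IsFrame σ (A.stalk t) a}
  is_open' := by
    rw [isOpen_iff_forall_mem_open]
    intro t ht
    obtain ⟨V, hV, a, ha⟩ := exists_local_frame A t ht
    exact ⟨V, fun y hy => ⟨_, ha y hy⟩, V.2, hV⟩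

lemma mem_frameLocus {T : Scheme.{u}} {A : Mold n d T} {t : T} :
    t ∈ frameLocus σ A ↔ ∃ a, IsFrame σ (A.stalk t) a := Iff.rfl

lemma mem_frameLocus_pullback {T T' : Scheme.{u}} (f : T' ⟶ T) (A : Mold n d T) (t : T') :
    t ∈ frameLocus σ (A.pullback f) ↔ f t ∈ frameLocus σ A := by
  constructor
  · rintro ⟨a, ha⟩
    obtain ⟨U, hU, e, b, hb⟩ := A.locally_free (f t)
    have h1 := toSubmodule_extend_of_span (f.stalkMap t).hom (hb (f t) hU)
    have h2 := isUnit_det_of_isFrame ha h1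
    refine ⟨_, exists_isFrame (hb (f t) hU) ?_⟩
    rw [← isUnit_map_iff (f.stalkMap t).hom, RingHom.map_det]
    exact h2
  · rintro ⟨a, ha⟩
    exact ⟨_, ha.extend (f.stalkMap t).hom⟩

lemma exists_mem_frameLocus {T : Scheme.{u}} (A : Mold n d T) (t : T) :
    ∃ σ : Fin d → Fin n × Fin n, t ∈ frameLocus σ A := by
  obtain ⟨U, hU, e, b, hb⟩ := A.locally_free t
  obtain ⟨σ, hσ⟩ := exists_minor (mapBasis (T.presheaf.germ U t hU).hom b)
  simp_rw [mapBasis_apply] at hσ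
  exact ⟨σ, _, exists_isFrame (hb t hU) hσ⟩

end ChartMolds

section Gluing

variable {n d : ℕ}

/-- The map on stalks at a point `z` over a point `x`. -/
noncomputable def stalkAt {U X : Scheme.{u}} (f : U ⟶ X) (z : U) (x : X) (h : f z = x) :
    X.presheaf.stalk x →+* U.presheaf.stalk z :=
  (X.presheaf.stalkSpecializes (specializes_of_eq h) ≫ f.stalkMap z).hom

lemma stalkAt_rfl {U X : Scheme.{u}} (f : U ⟶ X) (z : U) :
    stalkAt f z (f z) rfl = (f.stalkMap z).hom := by
  simp [stalkAt]

lemma extend_stalkMap_injective {U X : Scheme.{u}} (f : U ⟶ X) [IsOpenImmersion f] (z : U) :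
    Function.Injective (extend (n := n) (f.stalkMap z).hom) := by
  apply extend_injective_of_leftInverse (ψ := (inv (f.stalkMap z)).hom)
  rw [← CommRingCat.hom_comp, IsIso.hom_inv_id]
  rfl

lemma extend_inv_stalkMap {U X : Scheme.{u}} (f : U ⟶ X) [IsOpenImmersion f] (z : U)
    (A : Subalgebra (U.presheaf.stalk z) (Matrix (Fin n) (Fin n) (U.presheaf.stalk z))) :
    extend (f.stalkMap z).hom (extend (inv (f.stalkMap z)).hom A) = A := by
  rw [← extend_comp, ← CommRingCat.hom_comp, IsIso.inv_hom_id]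
  exact extend_id A

variable {X : Scheme.{u}} {I : Type*} {U : I → Scheme.{u}} (f : ∀ i, U i ⟶ X)
  [∀ i, IsOpenImmersion (f i)] (a : ∀ i, Mold n d (U i))

lemma exists_glued_stalk (hf : ∀ x, ∃ i z, f i z = x)
    (ha : ∀ i j (Z : Scheme.{u}) (p : Z ⟶ U i) (q : Z ⟶ U j), p ≫ f i = q ≫ f j →
      (a i).pullback p = (a j).pullback q) (x : X) :
    ∃ B : Subalgebra (X.presheaf.stalk x) (Matrix (Fin n) (Fin n) (X.presheaf.stalk x)),
      ∀ i z (h : f i z = x), (a i).stalk z = extend (stalkAt (f i) z x h) B := by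
  obtain ⟨j, y, rfl⟩ := hf x
  refine ⟨extend (inv ((f j).stalkMap y)).hom ((a j).stalk y), fun i z h => ?_⟩
  obtain ⟨w, rfl, rfl⟩ := Scheme.Pullback.exists_preimage_pullback y z h.symm
  apply extend_stalkMap_injective (Limits.pullback.snd (f j) (f i)) w
  have h1 := congrArg (fun A => A.stalk w) (ha j i _ _ _ (Limits.pullback.condition (f := f j)
    (g := f i)))
  refine h1.symm.trans ?_
  rw [← extend_comp]
  have h2 : ((Limits.pullback.snd (f j) (f i)).stalkMap w).hom.comp
      (stalkAt (f i) (Limits.pullback.snd (f j) (f i) w) _ h) =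
      ((Limits.pullback.fst (f j) (f i)).stalkMap w).hom.comp
        ((f j).stalkMap (Limits.pullback.fst (f j) (f i) w)).hom := by
    rw [stalkAt, ← CommRingCat.hom_comp, ← CommRingCat.hom_comp, Category.assoc,
      ← Scheme.Hom.stalkMap_comp, ← Scheme.Hom.stalkMap_comp,
      Scheme.Hom.stalkMap_congr_hom _ _ (Limits.pullback.condition (f := f j) (g := f i)) w]
    rfl
  rw [h2, extend_comp, extend_inv_stalkMap]
  rfl

lemma exists_glued (hf : ∀ x, ∃ i z, f i z = x)
    (ha : ∀ i j (Z : Scheme.{u}) (p : Z ⟶ U i) (q : Z ⟶ U j), p ≫ f i = q ≫ f j →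
      (a i).pullback p = (a j).pullback q) :
    ∃ A : Mold n d X, ∀ i, A.pullback (f i) = a i := by
  choose B hB using exists_glued_stalk f a hf ha
  have hB' (i) (z : U i) : (a i).stalk z = extend ((f i).stalkMap z).hom (B (f i z)) := by
    rw [hB (f i z) i z rfl, stalkAt_rfl]
  refine ⟨⟨B, fun x => ?_⟩, fun i => ?_⟩
  · obtain ⟨i, z, rfl⟩ := hf x
    obtain ⟨V, hV, e, b, hb⟩ := (a i).locally_free z
    refine ⟨f i ''ᵁ V, ⟨z, hV, rfl⟩, e, mapBasis ((f i).appIso V).inv.hom b, ?_⟩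
    intro y hy
    have hy' : ∃ v ∈ V, f i v = y := hy
    obtain ⟨v, hv, rfl⟩ := hy'
    have h1 : B (f i v) = extend (inv ((f i).stalkMap v)).hom ((a i).stalk v) := by
      apply extend_stalkMap_injective (f i) v
      rw [extend_inv_stalkMap, hB']
    rw [h1, toSubmodule_extend_of_span _ (hb v hv)]
    congr 2
    funext k
    rw [mapBasis_apply]
    have h2 : (U i).presheaf.germ V v hv ≫ inv ((f i).stalkMap v) =
        ((f i).appIso V).inv ≫ X.presheaf.germ (f i ''ᵁ V) (f i v) hy := by
      rw [IsIso.comp_inv_eq, Category.assoc, Scheme.Hom.germ_stalkMap,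
        Scheme.Hom.appIso_inv_app_assoc]
      exact ((U i).presheaf.germ_res (eqToHom ((f i).preimage_image_eq V)) v hy).symm
    ext p q
    exact congrArg (fun φ => φ.hom (b (Sum.inl k) p q)) h2
  · apply Mold.ext
    funext z
    exact (hB' i z).symm

lemma glued_unique (hf : ∀ x, ∃ i z, f i z = x) {A A' : Mold n d X}
    (h : ∀ i, A.pullback (f i) = A'.pullback (f i)) : A = A' := by
  apply Mold.ext
  funext x
  obtain ⟨i, z, rfl⟩ := hf x
  apply extend_stalkMap_injective (f i) z
  exact congrArg (fun A => A.stalk z) (h i)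

end Gluing

lemma isSheaf_moldFunctor (n d : ℕ) :
    Presheaf.IsSheaf Scheme.zariskiTopology.{u} (moldFunctor.{u} n d) := by
  rw [isSheaf_iff_isSheaf_of_type, Scheme.zariskiTopology, Scheme.grothendieckTopology,
    Precoverage.isSheaf_toGrothendieck_iff_of_isStableUnderBaseChange]
  intro X R hR
  obtain ⟨(𝓤 : X.OpenCover), rfl⟩ := Scheme.exists_cover_of_mem_pretopology hR
  rw [Presieve.isSheafFor_arrows_iff]
  intro a ha
  have hf (x : X) : ∃ i z, 𝓤.f i z = x := by
    obtain ⟨z, hz⟩ := 𝓤.covers x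
    exact ⟨_, z, hz⟩
  obtain ⟨A, hA⟩ := exists_glued 𝓤.f a hf (fun i j Z p q h => ha i j Z p q h)
  refine ⟨A, hA, fun A' hA' => glued_unique 𝓤.f hf fun i => ?_⟩
  exact (hA' i).trans (hA i).symm

lemma moldFunctor_map (n d : ℕ) {X Y : Scheme.{u}} (f : X ⟶ Y) (A : Mold n d Y) :
    (moldFunctor n d).map f.op A = A.pullback f := rfl

/-- The morphism of functors given by the universal mold on a chart. -/
noncomputable def chartMap {n d : ℕ} (σ : Fin d → Fin n × Fin n) :
    yoneda.obj (Spec (CommRingCat.of (ChartRing.{u} σ))) ⟶ moldFunctor.{u} n d :=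
  yonedaEquiv.symm (chartMold σ)

lemma chartMap_app {n d : ℕ} (σ : Fin d → Fin n × Fin n) {T : Scheme.{u}}
    (g : T ⟶ Spec (CommRingCat.of (ChartRing.{u} σ))) :
    (chartMap σ).app (op T) g = (chartMold σ).pullback g := rfl

section Representability

variable {n d : ℕ}

lemma chartMap_mono_app (σ : Fin d → Fin n × Fin n) {T : Scheme.{u}}
    {g g' : T ⟶ Spec (CommRingCat.of (ChartRing.{u} σ))}
    (h : (chartMap σ).app (op T) g = (chartMap σ).app (op T) g') : g = g' :=
  chart_hom_ext h

instance (σ : Fin d → Fin n × Fin n) : Mono (chartMap.{u} σ) := by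
  refine ⟨fun {Z} p q h => ?_⟩
  apply NatTrans.ext
  funext T
  refine ConcreteCategory.hom_ext _ _ fun z => ?_
  have h1 := ConcreteCategory.congr_hom (congrArg (fun f => NatTrans.app f T) h) z
  exact chartMap_mono_app σ (T := T.unop) h1

/-- The mold attached to a morphism to the functor of molds. -/
noncomputable def toMold {T : Scheme.{u}} (γ : yoneda.obj T ⟶ moldFunctor.{u} n d) :
    Mold n d T :=
  yonedaEquiv γ

lemma app_eq_pullback {T : Scheme.{u}} (γ : yoneda.obj T ⟶ moldFunctor.{u} n d)
    {T' : Scheme.{u}} (h : T' ⟶ T) :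
    γ.app (op T') h = Mold.pullback h (toMold γ) :=
  (map_yonedaEquiv γ h).symm

lemma mem_frameLocus_of_comp_eq {σ : Fin d → Fin n × Fin n} {T : Scheme.{u}}
    (γ : yoneda.obj T ⟶ moldFunctor.{u} n d) {Z : Scheme.{u}ᵒᵖ ⥤ Type u}
    (p : Z ⟶ yoneda.obj (Spec (CommRingCat.of (ChartRing.{u} σ)))) (q : Z ⟶ yoneda.obj T)
    (h : p ≫ chartMap σ = q ≫ γ) (T' : Scheme.{u}) (z : Z.obj (op T')) (g : T' ⟶ T)
    (hg : q.app (op T') z = g) (t : T') :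
    g t ∈ frameLocus σ (toMold γ) := by
  have h0 : (p ≫ chartMap σ).app (op T') z = (q ≫ γ).app (op T') z := by rw [h]
  rw [NatTrans.comp_app_apply, NatTrans.comp_app_apply, hg] at h0
  have h1 : (chartMold σ).pullback (p.app (op T') z) =
      Mold.pullback g (toMold γ) := h0.trans (app_eq_pullback γ g)
  rw [← mem_frameLocus_pullback, ← h1]
  exact ⟨_, isFrame_pullback_chartMold _ t⟩

lemma chartMap_isOpenImmersion (σ : Fin d → Fin n × Fin n) :
    IsOpenImmersion.presheaf (chartMap.{u} σ) := by
  apply MorphismProperty.relative.of_exists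
  intro T γ
  let A : Mold n d T := toMold γ
  let V := frameLocus σ A
  obtain ⟨g, hg⟩ := exists_chart_hom (σ := σ) (A.pullback V.ι) (fun t => by
    rw [← mem_frameLocus, mem_frameLocus_pullback]
    exact t.2)
  have w : yoneda.map g ≫ chartMap σ = yoneda.map V.ι ≫ γ := by
    apply yonedaEquiv.injective
    refine Eq.trans ?_ (app_eq_pullback γ (𝟙 (V : Scheme.{u}) ≫ V.ι)).symm
    change (chartMold σ).pullback (𝟙 (V : Scheme.{u}) ≫ g) = _
    rw [Category.id_comp, Category.id_comp, hg]
  have hmem (s : PullbackCone (chartMap σ) γ) (T' : Schemeᵒᵖ) (z : s.pt.obj T') :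
      Set.range (show T'.unop ⟶ T from s.snd.app T' z) ⊆ Set.range V.ι := by
    rintro _ ⟨t, rfl⟩
    rw [Scheme.Opens.range_ι]
    exact mem_frameLocus_of_comp_eq γ s.fst s.snd s.condition T'.unop z _ rfl t
  let l (s : PullbackCone (chartMap σ) γ) : s.pt ⟶ yoneda.obj (V : Scheme.{u}) :=
    { app T' := TypeCat.ofHom fun z => IsOpenImmersion.lift V.ι (s.snd.app T' z) (hmem s T' z)
      naturality T₁ T₂ h := by
        refine ConcreteCategory.hom_ext _ _ fun z => ?_
        change IsOpenImmersion.lift V.ι _ _ = h.unop ≫ IsOpenImmersion.lift V.ι _ _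
        rw [← cancel_mono V.ι, IsOpenImmersion.lift_fac, Category.assoc, IsOpenImmersion.lift_fac]
        exact ConcreteCategory.congr_hom (s.snd.naturality h) z }
  have hl (s : PullbackCone (chartMap σ) γ) : l s ≫ yoneda.map V.ι = s.snd := by
    apply NatTrans.ext
    funext T'
    refine ConcreteCategory.hom_ext _ _ fun z => ?_
    exact IsOpenImmersion.lift_fac V.ι _ _
  refine ⟨V, yoneda.map g, V.ι, ⟨⟨w⟩, ⟨PullbackCone.IsLimit.mk w l ?_ hl ?_⟩⟩, inferInstance⟩
  · intro s
    rw [← cancel_mono (chartMap σ), Category.assoc, w, reassoc_of% hl s, s.condition]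
  · intro s m _ hm
    rw [← cancel_mono (yoneda.map V.ι), hm, hl]

lemma isLocallySurjective_charts :
    Presheaf.IsLocallySurjective Scheme.zariskiTopology.{u}
      (Sigma.desc (fun σ : ULift.{u} (Fin d → Fin n × Fin n) => chartMap.{u} σ.down)) where
  imageSieve_mem {T} A := by
    let A : Mold n d T := A
    have hU : TopologicalSpace.IsOpenCover
        (fun σ : Fin d → Fin n × Fin n => frameLocus σ A) := by
      rw [TopologicalSpace.IsOpenCover, eq_top_iff]
      intro t _
      rw [TopologicalSpace.Opens.mem_iSup]
      exact exists_mem_frameLocus A t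
    refine Scheme.zariskiTopology.superset_covering ?_
      (T.openCoverOfIsOpenCover _ hU).mem_grothendieckTopology
    rintro W _ ⟨Z, p, _, ⟨(σ : Fin d → Fin n × Fin n)⟩, rfl⟩
    let p' : W ⟶ (frameLocus σ A : Scheme.{u}) := p
    obtain ⟨g, hg⟩ := exists_chart_hom (σ := σ) (A.pullback (frameLocus σ A).ι) (fun t => by
      rw [← mem_frameLocus, mem_frameLocus_pullback]
      exact t.2)
    refine ⟨(Sigma.ι (fun σ : ULift.{u} (Fin d → Fin n × Fin n) =>
      yoneda.obj (Spec (CommRingCat.of (ChartRing.{u} σ.down)))) ⟨σ⟩).app (op W) (p' ≫ g), ?_⟩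
    rw [← NatTrans.comp_app_apply, Sigma.ι_desc]
    change (chartMold σ).pullback (p' ≫ g) = A.pullback (p' ≫ (frameLocus σ A).ι)
    rw [Mold.pullback_comp, hg, Mold.pullback_comp]

/-- The functor of molds is representable. -/
theorem isRepresentable_moldFunctor (n d : ℕ) : (moldFunctor.{u} n d).IsRepresentable := by
  have := isLocallySurjective_charts.{u} (n := n) (d := d)
  exact Scheme.LocalRepresentability.isRepresentable
    (F := ⟨moldFunctor.{u} n d, isSheaf_moldFunctor n d⟩)
    (f := fun σ : ULift.{u} (Fin d → Fin n × Fin n) => chartMap.{u} σ.down)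
    (fun σ => chartMap_isOpenImmersion σ.down)

end Representability

section Hochschild

variable (k A M : Type*) [CommRing k] [Ring A] [Algebra k A] [AddCommGroup M] [Module k M]
  [Module A M] [Module Aᵐᵒᵖ M] [IsScalarTower k A M] [IsScalarTower k Aᵐᵒᵖ M]
  [SMulCommClass A Aᵐᵒᵖ M]

/-- The differential `d⁰ : M → Hom_k(A, M)`, `(d⁰ m)(a) = a m - m a`, of the Hochschild complex. -/
def hochschildD0 : M →ₗ[k] A →ₗ[k] M :=
  LinearMap.mk₂ k (fun m a => a • m - MulOpposite.op a • m)
    (fun m m' a => by simp only [smul_add]; abel)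
    (fun c m a => by
      have h1 : a • c • m = c • a • m := by
        rw [← algebraMap_smul A c m, ← algebraMap_smul A c (a • m), smul_smul, smul_smul,
          Algebra.commutes]
      have h2 : MulOpposite.op a • c • m = c • MulOpposite.op a • m := by
        rw [← algebraMap_smul Aᵐᵒᵖ c m, ← algebraMap_smul Aᵐᵒᵖ c (MulOpposite.op a • m),
          smul_smul, smul_smul, Algebra.commutes]
      rw [h1, h2, smul_sub])
    (fun m a b => by simp only [MulOpposite.op_add, add_smul]; abel)
    (fun c m a => by rw [smul_assoc, MulOpposite.op_smul, smul_assoc, smul_sub])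

/-- The differential `d¹ : Hom_k(A, M) → Hom_k(A ⊗ A, M)`,
`(d¹ f)(a, b) = a f(b) - f(ab) + f(a) b`, of the Hochschild complex. -/
def hochschildD1 : (A →ₗ[k] M) →ₗ[k] A →ₗ[k] A →ₗ[k] M where
  toFun f := LinearMap.mk₂ k (fun a b => a • f b - f (a * b) + MulOpposite.op b • f a)
    (fun a a' b => by simp only [add_mul, map_add, add_smul, smul_add]; abel)
    (fun c a b => by
      have h2 : MulOpposite.op b • c • f a = c • MulOpposite.op b • f a := by
        rw [← algebraMap_smul Aᵐᵒᵖ c (f a), ← algebraMap_smul Aᵐᵒᵖ c (MulOpposite.op b • f a),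
          smul_smul, smul_smul, Algebra.commutes]
      rw [smul_mul_assoc, map_smul, map_smul, smul_assoc, h2, smul_add, smul_sub])
    (fun a b b' => by simp only [mul_add, map_add, MulOpposite.op_add, add_smul, smul_add]; abel)
    (fun c a b => by
      have h1 : a • c • f b = c • a • f b := by
        rw [← algebraMap_smul A c (f b), ← algebraMap_smul A c (a • f b), smul_smul, smul_smul,
          Algebra.commutes]
      rw [mul_smul_comm, map_smul, map_smul, h1, MulOpposite.op_smul, smul_assoc, smul_add,
        smul_sub])
  map_add' f g := by
    ext a b
    simp only [LinearMap.mk₂_apply, LinearMap.add_apply, smul_add]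
    abel
  map_smul' c f := by
    ext a b
    have h1 : a • c • f b = c • a • f b := by
      rw [← algebraMap_smul A c (f b), ← algebraMap_smul A c (a • f b), smul_smul, smul_smul,
        Algebra.commutes]
    have h2 : MulOpposite.op b • c • f a = c • MulOpposite.op b • f a := by
      rw [← algebraMap_smul Aᵐᵒᵖ c (f a), ← algebraMap_smul Aᵐᵒᵖ c (MulOpposite.op b • f a),
        smul_smul, smul_smul, Algebra.commutes]
    simp only [LinearMap.mk₂_apply, LinearMap.smul_apply, RingHom.id_apply, h1, h2, smul_add,
      smul_sub]

lemma hochschildD1_comp_hochschildD0 : hochschildD1 k A M ∘ₗ hochschildD0 k A M = 0 := by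
  ext m a b
  simp only [hochschildD0, hochschildD1, LinearMap.comp_apply, LinearMap.coe_mk, AddHom.coe_mk,
    LinearMap.mk₂_apply, smul_sub, LinearMap.zero_apply, MulOpposite.op_mul, mul_smul]
  rw [smul_comm a (MulOpposite.op b) m]
  abel

/-- The first Hochschild cohomology `H¹(A, M) = ker d¹ / im d⁰` of a `k`-algebra `A` with
coefficients in an `A`-bimodule `M`. -/
abbrev HochschildH1 : Type _ :=
  LinearMap.ker (hochschildD1 k A M) ⧸
    (LinearMap.range (hochschildD0 k A M)).submoduleOf (LinearMap.ker (hochschildD1 k A M))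

end Hochschild

section QuotBimodule

variable {k B : Type*} [CommRing k] [Ring B] [Algebra k B]

/-- The quotient `B / A` of an algebra by a subalgebra; it is an `A`-bimodule through
`a · [b] = [a b]` and `[b] · a = [b a]`. -/
def QuotBimodule (A : Subalgebra k B) : Type _ := B ⧸ Subalgebra.toSubmodule A

namespace QuotBimodule

variable (A : Subalgebra k B)

instance : AddCommGroup (QuotBimodule A) :=
  inferInstanceAs (AddCommGroup (B ⧸ Subalgebra.toSubmodule A))

instance : Module k (QuotBimodule A) :=
  inferInstanceAs (Module k (B ⧸ Subalgebra.toSubmodule A))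

/-- The class in `B / A` of an element of `B`. -/
def mk : B →ₗ[k] QuotBimodule A := (Subalgebra.toSubmodule A).mkQ

lemma mk_surjective : Function.Surjective (mk A) := Submodule.mkQ_surjective _

/-- Left multiplication by an element of `A` on `B / A`. -/
def left (a : A) : QuotBimodule A →ₗ[k] QuotBimodule A :=
  (Subalgebra.toSubmodule A).mapQ (Subalgebra.toSubmodule A) (LinearMap.mulLeft k (a : B))
    fun _ hb => A.mul_mem a.2 hb

/-- Right multiplication by an element of `A` on `B / A`. -/
def right (a : A) : QuotBimodule A →ₗ[k] QuotBimodule A :=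
  (Subalgebra.toSubmodule A).mapQ (Subalgebra.toSubmodule A) (LinearMap.mulRight k (a : B))
    fun _ hb => A.mul_mem hb a.2

instance : SMul A (QuotBimodule A) := ⟨fun a q => left A a q⟩

instance : SMul (A)ᵐᵒᵖ (QuotBimodule A) := ⟨fun a q => right A a.unop q⟩

lemma smul_mk (a : A) (b : B) : a • mk A b = mk A (a * b) := rfl

lemma op_smul_mk (a : (A)ᵐᵒᵖ) (b : B) : a • mk A b = mk A (b * a.unop) := rfl

instance : Module A (QuotBimodule A) where
  one_smul q := by
    obtain ⟨b, rfl⟩ := mk_surjective A q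
    rw [smul_mk, OneMemClass.coe_one, one_mul]
  mul_smul a a' q := by
    obtain ⟨b, rfl⟩ := mk_surjective A q
    simp only [smul_mk, MulMemClass.coe_mul, mul_assoc]
  smul_zero a := map_zero (left A a)
  smul_add a := map_add (left A a)
  add_smul a a' q := by
    obtain ⟨b, rfl⟩ := mk_surjective A q
    simp only [smul_mk, AddMemClass.coe_add, add_mul, map_add]
  zero_smul q := by
    obtain ⟨b, rfl⟩ := mk_surjective A q
    rw [smul_mk, ZeroMemClass.coe_zero, zero_mul, map_zero]

instance : Module (A)ᵐᵒᵖ (QuotBimodule A) where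
  one_smul q := by
    obtain ⟨b, rfl⟩ := mk_surjective A q
    rw [op_smul_mk, MulOpposite.unop_one, OneMemClass.coe_one, mul_one]
  mul_smul a a' q := by
    obtain ⟨b, rfl⟩ := mk_surjective A q
    simp only [op_smul_mk, MulOpposite.unop_mul, MulMemClass.coe_mul, mul_assoc]
  smul_zero a := map_zero (right A a.unop)
  smul_add a := map_add (right A a.unop)
  add_smul a a' q := by
    obtain ⟨b, rfl⟩ := mk_surjective A q
    simp only [op_smul_mk, MulOpposite.unop_add, AddMemClass.coe_add, mul_add, map_add]
  zero_smul q := by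
    obtain ⟨b, rfl⟩ := mk_surjective A q
    rw [op_smul_mk, MulOpposite.unop_zero, ZeroMemClass.coe_zero, mul_zero, map_zero]

instance : IsScalarTower k A (QuotBimodule A) where
  smul_assoc c a q := by
    obtain ⟨b, rfl⟩ := mk_surjective A q
    rw [smul_mk, smul_mk, ← map_smul, Subalgebra.coe_smul, smul_mul_assoc]

instance : IsScalarTower k (A)ᵐᵒᵖ (QuotBimodule A) where
  smul_assoc c a q := by
    obtain ⟨b, rfl⟩ := mk_surjective A q
    rw [op_smul_mk, op_smul_mk, ← map_smul, MulOpposite.unop_smul, Subalgebra.coe_smul,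
      mul_smul_comm]

instance : SMulCommClass A (A)ᵐᵒᵖ (QuotBimodule A) where
  smul_comm a a' q := by
    obtain ⟨b, rfl⟩ := mk_surjective A q
    simp only [smul_mk, op_smul_mk, mul_assoc]

end QuotBimodule

end QuotBimodule

section PGL

variable (n : ℕ)

/-- The generic `n × n` matrix over `ℤ`, whose entries are the variables `X_{ij}`. -/
noncomputable abbrev genericMatrix :
    Matrix (Fin n) (Fin n) (MvPolynomial (Fin n × Fin n) (ULift.{u} ℤ)) :=
  Matrix.mvPolynomialX (Fin n) (Fin n) (ULift.{u} ℤ)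

variable {n}

lemma isHomogeneous_det {m : ℕ} {s : Type*} {R : Type*} [CommRing R]
    (a : Matrix (Fin m) (Fin m) (MvPolynomial s R)) (h : ∀ i j, (a i j).IsHomogeneous 1) :
    a.det.IsHomogeneous m := by
  rw [Matrix.det_apply]
  refine MvPolynomial.IsHomogeneous.sum _ _ _ fun p _ => ?_
  have h1 : (∏ i, a (p i) i).IsHomogeneous m := by
    have := MvPolynomial.IsHomogeneous.prod (Finset.univ : Finset (Fin m)) (fun i => a (p i) i)
      (fun _ => 1) (fun i _ => h _ _)
    simpa using this
  rcases Int.units_eq_one_or (Equiv.Perm.sign p) with hp | hp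
  · rw [hp, one_smul]; exact h1
  · rw [hp, Units.neg_smul, one_smul]; exact h1.neg

lemma det_mem : (genericMatrix.{u} n).det ∈
    MvPolynomial.homogeneousSubmodule (Fin n × Fin n) (ULift.{u} ℤ) n := by
  rw [MvPolynomial.mem_homogeneousSubmodule]
  exact isHomogeneous_det _ fun i j => MvPolynomial.isHomogeneous_X _ _

lemma mul_adjugate_mem (i k l j : Fin n) :
    genericMatrix.{u} n i k * (genericMatrix.{u} n).adjugate l j ∈
      MvPolynomial.homogeneousSubmodule (Fin n × Fin n) (ULift.{u} ℤ) (1 • n) := by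
  rw [MvPolynomial.mem_homogeneousSubmodule]
  obtain ⟨m, rfl⟩ : ∃ m, n = m + 1 := ⟨n - 1, by have := i.2; omega⟩
  have h1 : (genericMatrix.{u} (m + 1) i k).IsHomogeneous 1 := MvPolynomial.isHomogeneous_X _ _
  have h2 : ((genericMatrix.{u} (m + 1)).adjugate l j).IsHomogeneous m := by
    rw [Matrix.adjugate_fin_succ_eq_det_submatrix]
    have h3 := isHomogeneous_det ((genericMatrix.{u} (m + 1)).submatrix j.succAbove l.succAbove)
      fun i j => MvPolynomial.isHomogeneous_X _ _
    rcases neg_one_pow_eq_or (MvPolynomial (Fin (m + 1) × Fin (m + 1)) (ULift.{u} ℤ))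
      (j + l : ℕ) with hp | hp
    · rw [hp, one_mul]; exact h3
    · rw [hp, neg_one_mul]; exact h3.neg
  have h3 := h1.mul h2
  have e : 1 + m = 1 • (m + 1) := by rw [one_smul, add_comm]
  exact e ▸ h3

variable (n)

noncomputable instance matrixGrading :
    GradedAlgebra (MvPolynomial.homogeneousSubmodule (Fin n × Fin n) (ULift.{u} ℤ)) :=
  MvPolynomial.gradedAlgebra

/-- The coordinate ring of `PGL_n` over `ℤ`: the degree zero part of `ℤ[X_{ij}][1/det]`. -/
abbrev PGLRing : Type u :=
  HomogeneousLocalization.Away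
    (MvPolynomial.homogeneousSubmodule (Fin n × Fin n) (ULift.{u} ℤ)) (genericMatrix.{u} n).det

/-- The scheme `PGL_n` over `ℤ`: the affine open subscheme `det ≠ 0` of the projective space of
`n × n` matrices. -/
noncomputable def PGL : Scheme.{u} := Spec (CommRingCat.of (PGLRing.{u} n))

variable {n}

/-- The regular function `P ↦ P_{ik} (P⁻¹)_{lj}` on `PGL_n`. -/
noncomputable def conjCoeff (i k l j : Fin n) : PGLRing.{u} n :=
  HomogeneousLocalization.Away.mk _ det_mem 1
    (genericMatrix.{u} n i k * (genericMatrix.{u} n).adjugate l j) (mul_adjugate_mem i k l j)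

/-- The generic matrix over `ℤ[X_{ij}][1/det]`. -/
noncomputable abbrev locMatrix (n : ℕ) :
    Matrix (Fin n) (Fin n) (Localization.Away (genericMatrix.{u} n).det) :=
  (algebraMap _ (Localization.Away (genericMatrix.{u} n).det)).mapMatrix (genericMatrix.{u} n)

lemma isUnit_det_locMatrix : IsUnit (locMatrix.{u} n).det := by
  rw [← RingHom.map_det]
  exact IsLocalization.Away.algebraMap_isUnit _

/-- The inclusion of the degree zero part into `ℤ[X_{ij}][1/det]`. -/
noncomputable def inclLoc (n : ℕ) : PGLRing.{u} n →+* Localization.Away (genericMatrix.{u} n).det where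
  toFun := HomogeneousLocalization.val
  map_one' := HomogeneousLocalization.val_one
  map_mul' := HomogeneousLocalization.val_mul
  map_zero' := HomogeneousLocalization.val_zero
  map_add' := HomogeneousLocalization.val_add

lemma inclLoc_injective : Function.Injective (inclLoc.{u} n) :=
  HomogeneousLocalization.val_injective _

lemma inclLoc_conjCoeff (i k l j : Fin n) :
    inclLoc.{u} n (conjCoeff i k l j) =
      locMatrix n i k * (locMatrix n)⁻¹ l j := by
  have hu := isUnit_det_locMatrix.{u} (n := n)
  change HomogeneousLocalization.val (conjCoeff i k l j) = _
  rw [conjCoeff, HomogeneousLocalization.Away.val_mk]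
  rw [Localization.mk_eq_mk'_apply, IsLocalization.mk'_eq_iff_eq_mul]
  have h : (algebraMap _ (Localization.Away (genericMatrix.{u} n).det))
      ((genericMatrix.{u} n).det) = (locMatrix n).det := RingHom.map_det _ _
  have h' : (locMatrix n).adjugate =
      (algebraMap _ (Localization.Away (genericMatrix.{u} n).det)).mapMatrix
        (genericMatrix.{u} n).adjugate := (RingHom.map_adjugate _ _).symm
  simp only [pow_one, map_mul, h]
  rw [Matrix.inv_def, h']
  simp only [Matrix.smul_apply, smul_eq_mul, RingHom.mapMatrix_apply, Matrix.map_apply]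
  have := Ring.inverse_mul_cancel _ hu
  simp only [RingHom.mapMatrix_apply] at this
  linear_combination (-1 : Localization.Away (genericMatrix.{u} n).det) * (algebraMap _ _
    (genericMatrix.{u} n i k)) * (algebraMap _ _ ((genericMatrix.{u} n).adjugate l j)) * this

end PGL

section Conjugation

variable {n d : ℕ}

lemma sum_conjCoeff_mul (i i' j j' : Fin n) :
    ∑ k, ∑ l, conjCoeff.{u} i k l j * conjCoeff.{u} j' l k i' =
      if i = i' ∧ j' = j then 1 else 0 := by
  apply inclLoc_injective
  have hu := isUnit_det_locMatrix.{u} (n := n)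
  have h1 : ∑ k, locMatrix.{u} n i k * (locMatrix.{u} n)⁻¹ k i' = if i = i' then 1 else 0 := by
    rw [← Matrix.mul_apply, Matrix.mul_nonsing_inv _ hu, Matrix.one_apply]
  have h2 : ∑ l, locMatrix.{u} n j' l * (locMatrix.{u} n)⁻¹ l j = if j' = j then 1 else 0 := by
    rw [← Matrix.mul_apply, Matrix.mul_nonsing_inv _ hu, Matrix.one_apply]
  simp only [map_sum, map_mul, inclLoc_conjCoeff]
  calc _ = (∑ k, locMatrix.{u} n i k * (locMatrix.{u} n)⁻¹ k i') *
        ∑ l, locMatrix.{u} n j' l * (locMatrix.{u} n)⁻¹ l j := by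
        rw [Finset.sum_mul_sum]
        exact Finset.sum_congr rfl fun k _ => Finset.sum_congr rfl fun l _ => by ring
    _ = _ := by
        rw [h1, h2]
        split_ifs <;> simp_all

lemma sum_conjCoeff_mul' (i i' j j' : Fin n) :
    ∑ k, ∑ l, conjCoeff.{u} l j i k * conjCoeff.{u} k i' j' l =
      if i = i' ∧ j' = j then 1 else 0 := by
  apply inclLoc_injective
  have hu := isUnit_det_locMatrix.{u} (n := n)
  have h1 : ∑ k, (locMatrix.{u} n)⁻¹ i k * locMatrix.{u} n k i' = if i = i' then 1 else 0 := by
    rw [← Matrix.mul_apply, Matrix.nonsing_inv_mul _ hu, Matrix.one_apply]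
  have h2 : ∑ l, (locMatrix.{u} n)⁻¹ j' l * locMatrix.{u} n l j = if j' = j then 1 else 0 := by
    rw [← Matrix.mul_apply, Matrix.nonsing_inv_mul _ hu, Matrix.one_apply]
  simp only [map_sum, map_mul, inclLoc_conjCoeff]
  calc _ = (∑ k, (locMatrix.{u} n)⁻¹ i k * locMatrix.{u} n k i') *
        ∑ l, (locMatrix.{u} n)⁻¹ j' l * locMatrix.{u} n l j := by
        rw [Finset.sum_mul_sum]
        exact Finset.sum_congr rfl fun k _ => Finset.sum_congr rfl fun l _ => by ring
    _ = _ := by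
        rw [h1, h2]
        split_ifs <;> simp_all

lemma sum_conjCoeff_self (i j : Fin n) :
    ∑ k, conjCoeff.{u} i k k j = if i = j then 1 else 0 := by
  apply inclLoc_injective
  simp only [map_sum, inclLoc_conjCoeff]
  rw [← Matrix.mul_apply, Matrix.mul_nonsing_inv _ isUnit_det_locMatrix, Matrix.one_apply]
  split_ifs <;> simp

lemma sum_conjCoeff_conjCoeff (i k l k' l' j : Fin n) :
    ∑ m, conjCoeff.{u} i k l m * conjCoeff.{u} m k' l' j =
      if l = k' then conjCoeff.{u} i k l' j else 0 := by
  apply inclLoc_injective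
  have h1 : ∑ m, (locMatrix.{u} n)⁻¹ l m * locMatrix.{u} n m k' = if l = k' then 1 else 0 := by
    rw [← Matrix.mul_apply, Matrix.nonsing_inv_mul _ isUnit_det_locMatrix, Matrix.one_apply]
  simp only [map_sum, map_mul, inclLoc_conjCoeff]
  calc _ = locMatrix.{u} n i k * (locMatrix.{u} n)⁻¹ l' j *
        ∑ m, (locMatrix.{u} n)⁻¹ l m * locMatrix.{u} n m k' := by
        rw [Finset.mul_sum]
        exact Finset.sum_congr rfl fun m _ => by ring
    _ = _ := by
        rw [h1]
        split_ifs
        · rw [inclLoc_conjCoeff, mul_one]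
        · simp

variable {R R' : Type*} [CommRing R] [CommRing R']

/-- The linear map `s ↦ P s P⁻¹` for an `R`-valued point `P` of `PGL_n`. -/
noncomputable def conjFun (ρ : PGLRing.{u} n →+* R) :
    Matrix (Fin n) (Fin n) R →ₗ[R] Matrix (Fin n) (Fin n) R where
  toFun s := Matrix.of fun i j => ∑ k, ∑ l, ρ (conjCoeff i k l j) * s k l
  map_add' s t := by
    ext i j
    simp [mul_add, Finset.sum_add_distrib]
  map_smul' c s := by
    ext i j
    simp only [Matrix.of_apply, Matrix.smul_apply, smul_eq_mul, Finset.mul_sum, RingHom.id_apply]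
    exact Finset.sum_congr rfl fun k _ => Finset.sum_congr rfl fun l _ => by ring

/-- The linear map `s ↦ P⁻¹ s P` for an `R`-valued point `P` of `PGL_n`. -/
noncomputable def conjInv (ρ : PGLRing.{u} n →+* R) :
    Matrix (Fin n) (Fin n) R →ₗ[R] Matrix (Fin n) (Fin n) R where
  toFun s := Matrix.of fun i j => ∑ k, ∑ l, ρ (conjCoeff l j i k) * s k l
  map_add' s t := by
    ext i j
    simp [mul_add, Finset.sum_add_distrib]
  map_smul' c s := by
    ext i j
    simp only [Matrix.of_apply, Matrix.smul_apply, smul_eq_mul, Finset.mul_sum, RingHom.id_apply]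
    exact Finset.sum_congr rfl fun k _ => Finset.sum_congr rfl fun l _ => by ring

lemma conjFun_apply (ρ : PGLRing.{u} n →+* R) (s : Matrix (Fin n) (Fin n) R) (i j : Fin n) :
    conjFun ρ s i j = ∑ k, ∑ l, ρ (conjCoeff i k l j) * s k l := rfl

lemma conjInv_apply (ρ : PGLRing.{u} n →+* R) (s : Matrix (Fin n) (Fin n) R) (i j : Fin n) :
    conjInv ρ s i j = ∑ k, ∑ l, ρ (conjCoeff l j i k) * s k l := rfl

lemma sum_swap4 (a : Fin n → Fin n → R) (b : Fin n → Fin n → Fin n → Fin n → R)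
    (s : Fin n → Fin n → R) :
    ∑ k, ∑ l, a k l * ∑ k', ∑ l', b k l k' l' * s k' l' =
      ∑ k', ∑ l', (∑ k, ∑ l, a k l * b k l k' l') * s k' l' := by
  simp only [← Fintype.sum_prod_type' (f := fun k l => a k l * ∑ k', ∑ l', b k l k' l' * s k' l'),
    ← Fintype.sum_prod_type' (f := fun k l => (∑ k', ∑ l', a k' l' * b k' l' k l) * s k l)]
  simp only [← Fintype.sum_prod_type', Finset.mul_sum, Finset.sum_mul]
  exact Fintype.sum_equiv (Equiv.prodComm _ _) _ _ fun x => (mul_assoc _ _ _).symm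

lemma conjFun_conjInv (ρ : PGLRing.{u} n →+* R) (s : Matrix (Fin n) (Fin n) R) :
    conjFun ρ (conjInv ρ s) = s := by
  ext i j
  simp only [conjFun_apply, conjInv_apply]
  rw [sum_swap4 (fun k l => ρ (conjCoeff i k l j)) (fun k l k' l' => ρ (conjCoeff l' l k k')) s]
  simp only [← map_mul, ← map_sum, sum_conjCoeff_mul]
  simp only [apply_ite ρ, map_one, map_zero, ite_mul, one_mul, zero_mul, ite_and]
  simp

lemma conjInv_conjFun (ρ : PGLRing.{u} n →+* R) (s : Matrix (Fin n) (Fin n) R) :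
    conjInv ρ (conjFun ρ s) = s := by
  ext i j
  simp only [conjFun_apply, conjInv_apply]
  rw [sum_swap4 (fun k l => ρ (conjCoeff l j i k)) (fun k l k' l' => ρ (conjCoeff k k' l' l)) s]
  simp only [← map_mul, ← map_sum, sum_conjCoeff_mul']
  simp only [apply_ite ρ, map_one, map_zero, ite_mul, one_mul, zero_mul, ite_and]
  simp

lemma conjFun_one (ρ : PGLRing.{u} n →+* R) : conjFun ρ 1 = 1 := by
  ext i j
  simp only [conjFun_apply, Matrix.one_apply, mul_ite, mul_one, mul_zero, Finset.sum_ite_eq,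
    Finset.mem_univ, if_true]
  rw [← map_sum, sum_conjCoeff_self]
  simp only [apply_ite ρ, map_one, map_zero]

lemma conjFun_mul (ρ : PGLRing.{u} n →+* R) (s t : Matrix (Fin n) (Fin n) R) :
    conjFun ρ (s * t) = conjFun ρ s * conjFun ρ t := by
  ext i j
  have h (k l k' l' : Fin n) :
      ∑ m, (ρ (conjCoeff i k l m) * s k l) * (ρ (conjCoeff m k' l' j) * t k' l') =
        if l = k' then ρ (conjCoeff i k l' j) * (s k l * t k' l') else 0 := by
    have := congrArg ρ (sum_conjCoeff_conjCoeff i k l k' l' j)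
    simp only [map_sum, map_mul, apply_ite ρ, map_zero] at this
    calc _ = (∑ m, ρ (conjCoeff i k l m) * ρ (conjCoeff m k' l' j)) * (s k l * t k' l') := by
          rw [Finset.sum_mul]
          exact Finset.sum_congr rfl fun m _ => by ring
      _ = _ := by rw [this, ite_mul, zero_mul]
  symm
  calc (conjFun ρ s * conjFun ρ t) i j
      = ∑ m, ∑ k, ∑ l, ∑ k', ∑ l',
        (ρ (conjCoeff i k l m) * s k l) * (ρ (conjCoeff m k' l' j) * t k' l') := by
        rw [Matrix.mul_apply]
        refine Finset.sum_congr rfl fun m _ => ?_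
        rw [conjFun_apply, conjFun_apply, Finset.sum_mul]
        refine Finset.sum_congr rfl fun k _ => ?_
        rw [Finset.sum_mul]
        refine Finset.sum_congr rfl fun l _ => ?_
        rw [Finset.mul_sum]
        exact Finset.sum_congr rfl fun k' _ => Finset.mul_sum _ _ _
    _ = ∑ k, ∑ l, ∑ k', ∑ l', ∑ m,
        (ρ (conjCoeff i k l m) * s k l) * (ρ (conjCoeff m k' l' j) * t k' l') := by
        rw [Finset.sum_comm]
        refine Finset.sum_congr rfl fun k _ => ?_
        rw [Finset.sum_comm]
        refine Finset.sum_congr rfl fun l _ => ?_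
        rw [Finset.sum_comm]
        refine Finset.sum_congr rfl fun k' _ => ?_
        rw [Finset.sum_comm]
    _ = conjFun ρ (s * t) i j := by
        simp only [h, conjFun_apply, Matrix.mul_apply, Finset.mul_sum]
        refine Finset.sum_congr rfl fun k _ => ?_
        refine Eq.trans ?_ Finset.sum_comm
        refine Finset.sum_congr rfl fun l _ => ?_
        rw [Finset.sum_comm]
        refine Finset.sum_congr rfl fun l' _ => ?_
        rw [Finset.sum_ite_eq, if_pos (Finset.mem_univ _)]

/-- Conjugation `s ↦ P s P⁻¹` of matrices over `R` by an `R`-valued point `P` of `PGL_n`, given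
as a ring homomorphism from the coordinate ring of `PGL_n`. -/
noncomputable def conjEquiv (ρ : PGLRing.{u} n →+* R) :
    Matrix (Fin n) (Fin n) R ≃ₐ[R] Matrix (Fin n) (Fin n) R :=
  AlgEquiv.ofLinearEquiv
    (LinearEquiv.ofLinearMap (conjFun ρ) (conjInv ρ) (LinearMap.ext (conjFun_conjInv ρ))
      (LinearMap.ext (conjInv_conjFun ρ)))
    (conjFun_one ρ) (conjFun_mul ρ)

lemma conjEquiv_symm_apply (ρ : PGLRing.{u} n →+* R) (s : Matrix (Fin n) (Fin n) R) :
    (conjEquiv ρ).symm s = conjInv ρ s := rfl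

/-- If `P` lifts to an invertible matrix over `R`, then `conjEquiv` is conjugation by it. -/
lemma conjEquiv_of_lift (φ : Localization.Away (genericMatrix.{u} n).det →+* R)
    (s : Matrix (Fin n) (Fin n) R) :
    conjEquiv (φ.comp (inclLoc n)) s =
      φ.mapMatrix (locMatrix n) * s * φ.mapMatrix (locMatrix n)⁻¹ := by
  ext i j
  change conjFun _ s i j = _
  simp only [conjFun_apply, RingHom.comp_apply, inclLoc_conjCoeff, Matrix.mul_apply,
    Finset.sum_mul, RingHom.mapMatrix_apply, Matrix.map_apply, map_mul]
  rw [Finset.sum_comm]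
  exact Finset.sum_congr rfl fun k _ => Finset.sum_congr rfl fun l _ => by ring

lemma conjEquiv_symm_comp (φ : R →+* R') (ρ : PGLRing.{u} n →+* R)
    (s : Matrix (Fin n) (Fin n) R) :
    (conjEquiv (φ.comp ρ)).symm (φ.mapMatrix s) = φ.mapMatrix ((conjEquiv ρ).symm s) := by
  ext i j
  simp only [conjEquiv_symm_apply, conjInv_apply, RingHom.mapMatrix_apply, Matrix.map_apply, map_sum, map_mul,
    RingHom.comp_apply]

lemma toSubmodule_comap_of_span {A : Subalgebra R (Matrix (Fin n) (Fin n) R)} {ι : Type*}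
    {v : ι → Matrix (Fin n) (Fin n) R}
    (c : Matrix (Fin n) (Fin n) R ≃ₐ[R] Matrix (Fin n) (Fin n) R)
    (h : Subalgebra.toSubmodule A = Submodule.span R (Set.range v)) :
    Subalgebra.toSubmodule (A.comap c.toAlgHom) =
      Submodule.span R (Set.range fun i => c.symm (v i)) := by
  have h1 : Submodule.span R (Set.range fun i => c.symm (v i)) =
      (Submodule.span R (Set.range v)).map c.symm.toLinearMap := by
    rw [Submodule.map_span, ← Set.range_comp]
    rfl
  rw [h1, ← h]
  ext s
  constructor
  · intro hs
    exact ⟨c s, hs, c.symm_apply_apply s⟩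
  · rintro ⟨t, ht, rfl⟩
    change c (c.symm t) ∈ A
    rw [c.apply_symm_apply]
    exact ht

/-- The mold `P⁻¹ 𝒜 P = {s | P s P⁻¹ ∈ 𝒜}` for an `X`-valued point `P` of `PGL_n`. -/
noncomputable def Mold.conj {X : Scheme.{u}} (A : Mold n d X) (P : X ⟶ PGL.{u} n) :
    Mold n d X where
  stalk x := (A.stalk x).comap
    (conjEquiv ((germTop X x).comp (homOfSpec (R := CommRingCat.of (PGLRing.{u} n)) P))).toAlgHom
  locally_free x := by
    obtain ⟨U, hU, e, b, hb⟩ := A.locally_free x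
    let ρ : PGLRing.{u} n →+* Γ(X, U) := (X.presheaf.map (homOfLE le_top).op).hom.comp
      (homOfSpec (R := CommRingCat.of (PGLRing.{u} n)) P)
    refine ⟨U, hU, e, b.map (conjEquiv ρ).symm.toLinearEquiv, fun y hy => ?_⟩
    refine (toSubmodule_comap_of_span _ (hb y hy)).trans ?_
    congr 2
    funext i
    have : (germTop X y).comp (homOfSpec (R := CommRingCat.of (PGLRing.{u} n)) P) =
        (X.presheaf.germ U y hy).hom.comp ρ := by
      rw [← RingHom.comp_assoc, ← CommRingCat.hom_comp, X.presheaf.germ_res]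
    rw [this, conjEquiv_symm_comp]
    rfl

lemma extend_comap_conj (φ : R →+* R') (ρ : PGLRing.{u} n →+* R)
    (A : Subalgebra R (Matrix (Fin n) (Fin n) R)) :
    extend φ (A.comap (conjEquiv ρ).toAlgHom) =
      (extend φ A).comap (conjEquiv (φ.comp ρ)).toAlgHom := by
  apply Subalgebra.toSubmodule_injective
  have h : Subalgebra.toSubmodule A =
      Submodule.span R (Set.range (Subtype.val : A → Matrix (Fin n) (Fin n) R)) := by
    rw [Subtype.range_coe_subtype]
    exact (Submodule.span_eq (Subalgebra.toSubmodule A)).symm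
  rw [toSubmodule_extend_of_span φ (toSubmodule_comap_of_span _ h),
    toSubmodule_comap_of_span _ (toSubmodule_extend_of_span φ h)]
  simp only [conjEquiv_symm_comp]

/-- The formation of `P⁻¹ 𝒜 P` commutes with pullback. -/
lemma Mold.pullback_conj {X Y : Scheme.{u}} (f : X ⟶ Y) (A : Mold n d Y) (P : Y ⟶ PGL.{u} n) :
    (A.conj P).pullback f = (A.pullback f).conj (f ≫ P) := by
  apply Mold.ext
  funext x
  refine (extend_comap_conj _ _ _).trans ?_
  have h : (f.stalkMap x).hom.comp ((germTop Y (f x)).comp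
      (homOfSpec (R := CommRingCat.of (PGLRing.{u} n)) P)) =
      (germTop X x).comp (homOfSpec (R := CommRingCat.of (PGLRing.{u} n)) (f ≫ P)) := by
    rw [← RingHom.comp_assoc, stalkMap_germTop, RingHom.comp_assoc]
    exact congrArg _ (homOfSpec_comp (R := CommRingCat.of (PGLRing.{u} n)) f P).symm
  exact congrArg (fun ρ => ((A.pullback f).stalk x).comap (conjEquiv ρ).toAlgHom) h

end Conjugation

section Orbit

instance (n d : ℕ) : (moldFunctor.{u} n d).IsRepresentable := isRepresentable_moldFunctor n d

/-- The scheme `Mold_{n,d}` representing the functor `X ↦ {rank d molds of degree n on X}`. -/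
noncomputable def moldScheme (n d : ℕ) : Scheme.{u} := (moldFunctor.{u} n d).reprX

variable {n d : ℕ}

/-- The morphism `X ⟶ Mold_{n,d}` corresponding to a mold on `X`. -/
noncomputable def classify {X : Scheme.{u}} (A : Mold n d X) : X ⟶ moldScheme.{u} n d :=
  (moldFunctor.{u} n d).representableBy.homEquiv.symm A

/-- The base change `PGL_{n,S} = PGL_n ⊗_ℤ S`. -/
noncomputable abbrev PGLOver (n : ℕ) (S : Scheme.{u}) : Scheme.{u} :=
  Limits.pullback (terminal.from (PGL.{u} n)) (terminal.from S)

/-- The base change `Mold_{n,d} ⊗_ℤ S`. -/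
noncomputable abbrev MoldOver (n d : ℕ) (S : Scheme.{u}) : Scheme.{u} :=
  Limits.pullback (terminal.from (moldScheme.{u} n d)) (terminal.from S)

/-- The morphism `φ_𝒜 : PGL_{n,S} ⟶ Mold_{n,d} ⊗_ℤ S` over `S` given by `P ↦ P⁻¹ 𝒜 P`. It is
described by its value on the universal point `P` of `PGL_{n,S}`. -/
noncomputable def orbitMap {S : Scheme.{u}} (A : Mold n d S) :
    PGLOver.{u} n S ⟶ MoldOver.{u} n d S :=
  pullback.lift
    (classify ((A.pullback (pullback.snd _ _)).conj (pullback.fst _ _)))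
    (pullback.snd _ _) (terminal.hom_ext _ _)

lemma comp_classify {X Y : Scheme.{u}} (f : X ⟶ Y) (A : Mold n d Y) :
    f ≫ classify A = classify (A.pullback f) := by
  let r := (moldFunctor.{u} n d).representableBy
  apply r.homEquiv.injective
  refine (r.homEquiv_comp f (r.homEquiv.symm A)).trans ?_
  refine Eq.trans ?_ (r.homEquiv.apply_symm_apply (A.pullback f)).symm
  exact congrArg ((moldFunctor.{u} n d).map f.op) (r.homEquiv.apply_symm_apply A)

/-- On `X`-valued points `(P, f)` of `PGL_{n,S}` the morphism `φ_𝒜` is `P ↦ P⁻¹ (f^*𝒜) P`. -/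
lemma lift_orbitMap {S X : Scheme.{u}} (A : Mold n d S) (P : X ⟶ PGL.{u} n) (f : X ⟶ S) :
    pullback.lift P f (terminal.hom_ext _ _) ≫ orbitMap A =
      pullback.lift (classify ((A.pullback f).conj P)) f (terminal.hom_ext _ _) := by
  apply pullback.hom_ext
  · rw [Category.assoc, orbitMap, pullback.lift_fst, pullback.lift_fst, comp_classify,
      Mold.pullback_conj, ← Mold.pullback_comp, pullback.lift_fst, pullback.lift_snd]
  · rw [Category.assoc, orbitMap, pullback.lift_snd, pullback.lift_snd, pullback.lift_snd]

end Orbit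

end Moduli

/-! The orbit is the image of a smooth morphism, and smooth morphisms are open. The morphism is the
composite `GL_{n,S} → PGL_{n,S} → Mold_{n,d} ⊗ S`. Its first factor is surjective
(`comap_inclLoc_surjective`), so the composite has the same image as `orbitMap A`. Working with
`GL_n` makes every point an honest invertible matrix, which lifts along any square-zero extension of
rings.

Smoothness is finite presentation together with infinitesimal lifting. Let `R → R'` be surjective
with square-zero kernel `I`. Take `A` and another mold `B` over `R`, and a matrix over `R'` that
conjugates `A` into `B` modulo `I`. After lifting the matrix arbitrarily and conjugating `B`, the
two algebras agree modulo `I`. The difference of their normalized frames is then a derivation `A → I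
· (M_n/A)` (`derivationDefect_sub`). If it is inner, given by `x` with entries in `I`, then `1 + x`
conjugates `A` into `B` (`exists_conj_of_congr`, `exists_conj_lift`).

The hypothesis gives innerness only over residue fields. To spread it out, `H¹(A, M_n/A)` is written
as the middle cohomology of a complex of finite free modules `D₀`, `D₁` built from a frame
(`diffZero`, `diffOne`). Over `k(x)` exactness yields a contracting homotopy `D₀ H + K D₁ = 1`.
Lifting `H` and `K` to sections near `x` makes the left side invertible on a neighbourhood, and it
can then be corrected back to `1` (`exists_homotopy_of_isUnit_det`, `exists_isRigidFrame`). Such a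
matrix identity survives every base change and works with coefficients in any ideal, which is what
the lifting argument needs (`IsRigidFrame.map`, `IsRigidFrame.exists_coboundary`). -/

namespace Moduli

/-! ### Contracting homotopies of three-term complexes. -/

section LinearAlgebra

variable {R : Type*} [CommRing R] {ι₀ ι₁ ι₂ : Type*} [Fintype ι₀] [Fintype ι₁] [Fintype ι₂]
  [DecidableEq ι₁]

/-- The inverse of a matrix with invertible determinant is a polynomial in the matrix. -/
lemma exists_aeval_mul_eq_one (u : Matrix ι₁ ι₁ R) (hu : IsUnit u.det) :
    ∃ q : Polynomial R, Polynomial.aeval u q * u = 1 := by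
  obtain ⟨c, hc⟩ : ∃ c, c * u.charpoly.coeff 0 = 1 := by
    rw [Matrix.det_eq_sign_charpoly_coeff] at hu
    exact (isUnit_of_mul_isUnit_right hu).exists_left_inv
  -- Cayley–Hamilton: the characteristic polynomial without its constant term, evaluated at `u`, is
  -- minus that constant term, which is the determinant up to sign and hence a unit with inverse
  -- `c`.
  refine ⟨Polynomial.C (-c) * u.charpoly.divX, ?_⟩
  have h := Matrix.aeval_self_charpoly u
  rw [← u.charpoly.divX_mul_X_add, map_add, map_mul, Polynomial.aeval_X,
    Polynomial.aeval_C] at h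
  rw [map_mul, mul_assoc, eq_neg_of_add_eq_zero_left h, Polynomial.aeval_C, ← map_neg, ← map_mul,
    neg_mul_neg, hc, map_one]

/-- If `D₁ D₀ = 0` and `D₀ H + K D₁` is invertible, then it can be made the identity. -/
lemma exists_homotopy_of_isUnit_det {D₀ : Matrix ι₁ ι₀ R} {D₁ : Matrix ι₂ ι₁ R}
    (hD : D₁ * D₀ = 0) {H : Matrix ι₀ ι₁ R} {K : Matrix ι₁ ι₂ R}
    (hu : IsUnit (D₀ * H + K * D₁).det) :
    ∃ (H' : Matrix ι₀ ι₁ R) (K' : Matrix ι₁ ι₂ R), D₀ * H' + K' * D₁ = 1 := by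
  classical
  set u := D₀ * H + K * D₁ with hu_def
  obtain ⟨q, hq⟩ := exists_aeval_mul_eq_one u hu
  -- `u` is an endomorphism of the complex up to homotopy: the term `K * D₁` dies on `D₀`.
  have h1 : u * D₀ = D₀ * (H * D₀) := by
    rw [hu_def, Matrix.add_mul, Matrix.mul_assoc K, hD, Matrix.mul_zero, add_zero,
      Matrix.mul_assoc]
  have h2 : ∀ p : Polynomial R, Polynomial.aeval u p * D₀ = D₀ * Polynomial.aeval (H * D₀) p := by
    intro p
    induction p using Polynomial.induction_on' with
    | add p q hp hq => rw [map_add, map_add, Matrix.add_mul, Matrix.mul_add, hp, hq]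
    | monomial k r =>
      have h3 : u ^ k * D₀ = D₀ * (H * D₀) ^ k := by
        induction k with
        | zero => simp
        | succ k ih => rw [pow_succ, Matrix.mul_assoc, h1, ← Matrix.mul_assoc, ih, pow_succ,
            Matrix.mul_assoc]
      rw [Polynomial.aeval_monomial, Polynomial.aeval_monomial, ← Algebra.smul_def,
        ← Algebra.smul_def, Matrix.smul_mul, Matrix.mul_smul, h3]
  -- The identity is obtained by multiplying `D₀ * H + K * D₁` by the inverse of `u`. Moving that
  -- inverse to the right of `D₀` would ask for an inverse of `H * D₀`, which need not exist;
  -- written as a polynomial in `u`, it can be moved.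
  refine ⟨Polynomial.aeval (H * D₀) q * H, Polynomial.aeval u q * K, ?_⟩
  rw [← Matrix.mul_assoc, ← h2, Matrix.mul_assoc, Matrix.mul_assoc, ← Matrix.mul_add, ← hu_def, hq]

end LinearAlgebra

/-- An exact sequence of vector spaces splits. -/
lemma exists_homotopy_of_exact {k V₀ V₁ V₂ : Type*} [Field k] [AddCommGroup V₀] [Module k V₀]
    [AddCommGroup V₁] [Module k V₁] [AddCommGroup V₂] [Module k V₂] (d₀ : V₀ →ₗ[k] V₁)
    (d₁ : V₁ →ₗ[k] V₂) (h : ∀ v, d₁ v = 0 → ∃ w, d₀ w = v) :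
    ∃ (H : V₁ →ₗ[k] V₀) (K : V₂ →ₗ[k] V₁), d₀ ∘ₗ H + K ∘ₗ d₁ = LinearMap.id := by
  -- `K` extends to all of `V₂` a section of `d₁` over its image. Then `id - K d₁` lands in `ker
  -- d₁`, which lies in the image of `d₀`, and lifting it through `d₀` gives `H`.
  obtain ⟨s, hs⟩ := d₁.rangeRestrict.exists_rightInverse_of_surjective d₁.range_rangeRestrict
  obtain ⟨K, hK⟩ := s.exists_extend
  have h1 (v : V₁) : d₁ (v - K (d₁ v)) = 0 := by
    have h2 : K (d₁ v) = s (d₁.rangeRestrict v) := by rw [← hK]; rfl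
    have h3 : d₁ (s (d₁.rangeRestrict v)) = d₁ v :=
      congrArg Subtype.val (LinearMap.congr_fun hs (d₁.rangeRestrict v))
    rw [map_sub, h2, h3, sub_self]
  obtain ⟨H, hH⟩ := Module.projective_lifting_property d₀.rangeRestrict
    ((LinearMap.id - K ∘ₗ d₁).codRestrict (LinearMap.range d₀) fun v => h _ (h1 v))
    d₀.surjective_rangeRestrict
  refine ⟨H, K, ?_⟩
  have h4 : d₀ ∘ₗ H = LinearMap.id - K ∘ₗ d₁ := by
    ext v
    exact congrArg Subtype.val (LinearMap.congr_fun hH v)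
  rw [h4, sub_add_cancel]

/-! ### The complex of a normalized frame that computes `H¹(A, M_n/A)`. -/

section Complex

variable {n d : ℕ} {R R' : Type*} [CommRing R] [CommRing R']

/-- The tuple `[a_i, x] + ∑_j l_{ij} a_j` of matrices. -/
def coboundary (a : Fin d → Matrix (Fin n) (Fin n) R) (x : Matrix (Fin n) (Fin n) R)
    (l : Matrix (Fin d) (Fin d) R) (i : Fin d) : Matrix (Fin n) (Fin n) R :=
  a i * x - x * a i + ∑ j, l i j • a j

/-- The failure of the tuple `m` to be a derivation on the `a_i`. -/
def derivationDefect (σ : Fin d → Fin n × Fin n) (a m : Fin d → Matrix (Fin n) (Fin n) R)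
    (i j : Fin d) : Matrix (Fin n) (Fin n) R :=
  a i * m j + m i * a j - ∑ k, (a i * a j) (σ k).1 (σ k).2 • m k

/-- The projection along the span of the normalized sequence `a`. -/
def reduceMod (σ : Fin d → Fin n × Fin n) (a : Fin d → Matrix (Fin n) (Fin n) R)
    (v : Matrix (Fin n) (Fin n) R) : Matrix (Fin n) (Fin n) R :=
  v - ∑ k, v (σ k).1 (σ k).2 • a k

lemma derivationDefect_add (σ : Fin d → Fin n × Fin n) (a m m' : Fin d → Matrix (Fin n) (Fin n) R)
    (i j : Fin d) : derivationDefect σ a (m + m') i j =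
      derivationDefect σ a m i j + derivationDefect σ a m' i j := by
  simp only [derivationDefect, Pi.add_apply, mul_add, add_mul, smul_add, Finset.sum_add_distrib]
  abel

lemma derivationDefect_smul (σ : Fin d → Fin n × Fin n) (a m : Fin d → Matrix (Fin n) (Fin n) R)
    (c : R) (i j : Fin d) : derivationDefect σ a (c • m) i j = c • derivationDefect σ a m i j := by
  simp only [derivationDefect, Pi.smul_apply, mul_smul_comm, smul_mul_assoc, smul_add, smul_sub,
    Finset.smul_sum]
  congr 1
  exact Finset.sum_congr rfl fun k _ => smul_comm _ _ _

lemma reduceMod_add (σ : Fin d → Fin n × Fin n) (a : Fin d → Matrix (Fin n) (Fin n) R)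
    (v w : Matrix (Fin n) (Fin n) R) :
    reduceMod σ a (v + w) = reduceMod σ a v + reduceMod σ a w := by
  simp only [reduceMod, Matrix.add_apply, add_smul, Finset.sum_add_distrib]
  abel

lemma reduceMod_smul (σ : Fin d → Fin n × Fin n) (a : Fin d → Matrix (Fin n) (Fin n) R)
    (c : R) (v : Matrix (Fin n) (Fin n) R) :
    reduceMod σ a (c • v) = c • reduceMod σ a v := by
  simp only [reduceMod, Matrix.smul_apply, smul_assoc, ← Finset.smul_sum, smul_sub]

lemma map_coboundary (φ : R →+* R') (a : Fin d → Matrix (Fin n) (Fin n) R)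
    (x : Matrix (Fin n) (Fin n) R) (l : Matrix (Fin d) (Fin d) R) (i : Fin d) :
    φ.mapMatrix (coboundary a x l i) =
      coboundary (fun i => φ.mapMatrix (a i)) (φ.mapMatrix x) (φ.mapMatrix l) i := by
  simp only [coboundary, map_add, map_sub, map_mul, map_sum, mapMatrix_smul]
  rfl

lemma map_derivationDefect (φ : R →+* R') (σ : Fin d → Fin n × Fin n)
    (a m : Fin d → Matrix (Fin n) (Fin n) R) (i j : Fin d) :
    φ.mapMatrix (derivationDefect σ a m i j) =
      derivationDefect σ (fun i => φ.mapMatrix (a i)) (fun i => φ.mapMatrix (m i)) i j := by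
  simp only [derivationDefect, map_add, map_sub, map_mul, map_sum, mapMatrix_smul]
  simp only [← map_mul]
  rfl

lemma map_reduceMod (φ : R →+* R') (σ : Fin d → Fin n × Fin n)
    (a : Fin d → Matrix (Fin n) (Fin n) R) (v : Matrix (Fin n) (Fin n) R) :
    φ.mapMatrix (reduceMod σ a v) =
      reduceMod σ (fun i => φ.mapMatrix (a i)) (φ.mapMatrix v) := by
  simp only [reduceMod, map_sub, map_sum, mapMatrix_smul]
  rfl

/-- The coefficients of a vector in the span of a normalized frame can only be its entries at `σ`.
Hence `reduceMod` serves as the quotient map to `M_n/A`, in a form that commutes with ring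
homomorphisms. -/
lemma reduceMod_eq_zero_iff {σ : Fin d → Fin n × Fin n} {a : Fin d → Matrix (Fin n) (Fin n) R}
    (h : ∀ i k, a i (σ k).1 (σ k).2 = if i = k then 1 else 0) {v : Matrix (Fin n) (Fin n) R} :
    reduceMod σ a v = 0 ↔ v ∈ Submodule.span R (Set.range a) := by
  rw [reduceMod, sub_eq_zero]
  refine ⟨fun hv => ?_, expand_of_mem_span h⟩
  rw [hv]
  exact Submodule.sum_mem _ fun i _ => Submodule.smul_mem _ _ (Submodule.subset_span ⟨i, rfl⟩)

/-- The bracket with `x` is a derivation, so its contributions cancel exactly. The contributions of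
`l` stay in `A` because `A` is closed under products. Modulo `A` this is the statement that inner
derivations are derivations; the parameter `l` accounts for the choice of representatives in `M_n`
of classes in `M_n/A`. -/
lemma derivationDefect_coboundary_mem {σ : Fin d → Fin n × Fin n}
    {A : Subalgebra R (Matrix (Fin n) (Fin n) R)} {a : Fin d → Matrix (Fin n) (Fin n) R}
    (h : IsFrame σ A a) (x : Matrix (Fin n) (Fin n) R) (l : Matrix (Fin d) (Fin d) R)
    (i j : Fin d) : derivationDefect σ a (coboundary a x l) i j ∈ A := by
  have ha (i : Fin d) : a i ∈ A := by
    have : a i ∈ Subalgebra.toSubmodule A := by rw [h.span]; exact Submodule.subset_span ⟨i, rfl⟩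
    exact this
  have hl (i : Fin d) : ∑ j, l i j • a j ∈ A := sum_mem fun j _ => A.smul_mem (ha j) _
  have hmul : a i * a j = ∑ k, (a i * a j) (σ k).1 (σ k).2 • a k := by
    refine expand_of_mem_span h.delta ?_
    rw [← h.span]
    exact A.mul_mem (ha i) (ha j)
  have e : derivationDefect σ a (coboundary a x l) i j =
      a i * ∑ k, l j k • a k + (∑ k, l i k • a k) * a j -
        ∑ k, (a i * a j) (σ k).1 (σ k).2 • ∑ k', l k k' • a k' := by
    have e1 : ∑ k, (a i * a j) (σ k).1 (σ k).2 • (a k * x - x * a k) =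
        (a i * a j) * x - x * (a i * a j) := by
      conv_rhs => rw [hmul]
      rw [Finset.sum_mul, Finset.mul_sum, ← Finset.sum_sub_distrib]
      exact Finset.sum_congr rfl fun k _ => by rw [smul_sub, smul_mul_assoc, mul_smul_comm]
    simp only [derivationDefect, coboundary]
    simp_rw [smul_add, Finset.sum_add_distrib]
    rw [e1]
    -- With `p = a i` and `q = a j` this is the Leibniz rule for the bracket with `x`; only the
    -- `l`-terms `L`, `L'`, `S` remain.
    have e2 (p q L L' S : Matrix (Fin n) (Fin n) R) :
        p * (q * x - x * q + L) + (p * x - x * p + L') * q - (p * q * x - x * (p * q) + S) =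
          p * L + L' * q - S := by
      noncomm_ring
    exact e2 _ _ _ _ _
  rw [e]
  exact sub_mem (add_mem (mul_mem (ha i) (hl j)) (mul_mem (hl i) (ha j)))
    (sum_mem fun k _ => A.smul_mem (hl k) _)

/-- The first differential of the complex computing `H¹`, in coordinates. -/
def diffZero (a : Fin d → Matrix (Fin n) (Fin n) R) :
    ((Fin n × Fin n) ⊕ (Fin d × Fin d) → R) →ₗ[R] (Fin d × Fin n × Fin n → R) where
  toFun v p := coboundary a (Matrix.of fun i j => v (Sum.inl (i, j)))
    (Matrix.of fun i j => v (Sum.inr (i, j))) p.1 p.2.1 p.2.2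
  map_add' v w := by
    ext ⟨i, p, q⟩
    simp only [coboundary, Matrix.add_apply, Matrix.sub_apply, Matrix.mul_apply, Matrix.sum_apply,
      Matrix.smul_apply, Matrix.of_apply, Pi.add_apply, mul_add, add_mul, smul_eq_mul,
      Finset.sum_add_distrib]
    ring
  map_smul' c v := by
    ext ⟨i, p, q⟩
    simp only [coboundary, Matrix.add_apply, Matrix.sub_apply, Matrix.mul_apply, Matrix.sum_apply,
      Matrix.smul_apply, Matrix.of_apply, Pi.smul_apply, smul_eq_mul, RingHom.id_apply, mul_add,
      mul_sub, Finset.mul_sum, mul_left_comm, mul_assoc]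

/-- The second differential of the complex computing `H¹`, in coordinates. -/
def diffOne (σ : Fin d → Fin n × Fin n) (a : Fin d → Matrix (Fin n) (Fin n) R) :
    (Fin d × Fin n × Fin n → R) →ₗ[R] (Fin d × Fin d × Fin n × Fin n → R) where
  toFun m p := reduceMod σ a (derivationDefect σ a (fun i => Matrix.of fun j k => m (i, j, k))
    p.1 p.2.1) p.2.2.1 p.2.2.2
  map_add' v w := by
    funext p
    refine Eq.trans ?_ (congrFun (congrFun (reduceMod_add σ a _ _) p.2.2.1) p.2.2.2)
    rw [← derivationDefect_add]
    rfl
  map_smul' c v := by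
    funext p
    refine Eq.trans ?_ (congrFun (congrFun (reduceMod_smul σ a c _) p.2.2.1) p.2.2.2)
    rw [← derivationDefect_smul]
    rfl

/-- The complex computing `H¹` is split exact in the middle. -/
def IsRigidFrame (σ : Fin d → Fin n × Fin n) (a : Fin d → Matrix (Fin n) (Fin n) R) : Prop :=
  ∃ (H : Matrix ((Fin n × Fin n) ⊕ (Fin d × Fin d)) (Fin d × Fin n × Fin n) R)
    (K : Matrix (Fin d × Fin n × Fin n) (Fin d × Fin d × Fin n × Fin n) R),
    LinearMap.toMatrix' (diffZero a) * H + K * LinearMap.toMatrix' (diffOne σ a) = 1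

lemma toMatrix_diffZero_map (φ : R →+* R') (a : Fin d → Matrix (Fin n) (Fin n) R) :
    LinearMap.toMatrix' (diffZero fun i => φ.mapMatrix (a i)) =
      (LinearMap.toMatrix' (diffZero a)).map φ := by
  ext ⟨i, p, q⟩ j
  rw [Matrix.map_apply, LinearMap.toMatrix'_apply, LinearMap.toMatrix'_apply]
  have h := congrFun (congrFun (map_coboundary φ a
    (Matrix.of fun i k => (Pi.single j 1 : _ → R) (Sum.inl (i, k)))
    (Matrix.of fun i k => (Pi.single j 1 : _ → R) (Sum.inr (i, k))) i) p) q
  refine Eq.trans ?_ h.symm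
  have e : (Pi.single j 1 : (Fin n × Fin n) ⊕ (Fin d × Fin d) → R') =
      φ ∘ (Pi.single j 1 : (Fin n × Fin n) ⊕ (Fin d × Fin d) → R) := by
    ext k
    simp [Pi.single_apply, apply_ite φ]
  rw [e]
  rfl

lemma toMatrix_diffOne_map (φ : R →+* R') (σ : Fin d → Fin n × Fin n)
    (a : Fin d → Matrix (Fin n) (Fin n) R) :
    LinearMap.toMatrix' (diffOne σ fun i => φ.mapMatrix (a i)) =
      (LinearMap.toMatrix' (diffOne σ a)).map φ := by
  ext ⟨i, i', p, q⟩ j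
  rw [Matrix.map_apply, LinearMap.toMatrix'_apply, LinearMap.toMatrix'_apply]
  have h := map_reduceMod φ σ a (derivationDefect σ a
    (fun i => Matrix.of fun k l => (Pi.single j 1 : _ → R) (i, k, l)) i i')
  rw [map_derivationDefect] at h
  refine Eq.trans ?_ (congrFun (congrFun h p) q).symm
  have e : (Pi.single j 1 : Fin d × Fin n × Fin n → R') =
      φ ∘ (Pi.single j 1 : Fin d × Fin n × Fin n → R) := by
    ext k
    simp [Pi.single_apply, apply_ite φ]
  rw [e]
  rfl

/-- Exactness alone would not survive base change; an equation between matrices does. This is the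
reason for defining rigidity through a homotopy. -/
lemma IsRigidFrame.map (φ : R →+* R') {σ : Fin d → Fin n × Fin n}
    {a : Fin d → Matrix (Fin n) (Fin n) R} (h : IsRigidFrame σ a) :
    IsRigidFrame σ (fun i => φ.mapMatrix (a i)) := by
  obtain ⟨H, K, h⟩ := h
  refine ⟨H.map φ, K.map φ, ?_⟩
  rw [toMatrix_diffZero_map, toMatrix_diffOne_map, ← Matrix.map_mul, ← Matrix.map_mul,
    ← Matrix.map_add φ (map_add φ), h, Matrix.map_one φ (map_zero φ) (map_one φ)]

lemma toMatrix_diffOne_mul_diffZero {σ : Fin d → Fin n × Fin n}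
    {A : Subalgebra R (Matrix (Fin n) (Fin n) R)} {a : Fin d → Matrix (Fin n) (Fin n) R}
    (h : IsFrame σ A a) :
    LinearMap.toMatrix' (diffOne σ a) * LinearMap.toMatrix' (diffZero a) = 0 := by
  rw [← LinearMap.toMatrix'_comp]
  have : diffOne σ a ∘ₗ diffZero a = 0 := by
    refine LinearMap.ext fun v => funext fun ⟨i, j, p, q⟩ => ?_
    have h1 := derivationDefect_coboundary_mem h (Matrix.of fun i j => v (Sum.inl (i, j)))
      (Matrix.of fun i j => v (Sum.inr (i, j))) i j
    rw [← Subalgebra.mem_toSubmodule, h.span, ← reduceMod_eq_zero_iff h.delta] at h1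
    exact congrFun (congrFun h1 p) q
  rw [this, map_zero]

/-- Over a rigid frame, tuples with entries in an ideal `I` that are derivations are inner, with
entries in `I`. -/
lemma IsRigidFrame.exists_coboundary {σ : Fin d → Fin n × Fin n}
    {a : Fin d → Matrix (Fin n) (Fin n) R} (h : IsRigidFrame σ a) (I : Ideal R)
    (m : Fin d → Matrix (Fin n) (Fin n) R) (hm : ∀ i p q, m i p q ∈ I)
    (hd : ∀ i j, reduceMod σ a (derivationDefect σ a m i j) = 0) :
    ∃ x l, (∀ p q, x p q ∈ I) ∧ (∀ i j, l i j ∈ I) ∧ ∀ i, m i = coboundary a x l i := by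
  obtain ⟨H, K, h⟩ := h
  let m' : Fin d × Fin n × Fin n → R := fun p => m p.1 p.2.1 p.2.2
  have h1 : diffOne σ a m' = 0 := by
    funext ⟨i, j, p, q⟩
    exact congrFun (congrFun (hd i j) p) q
  -- Applied to a cocycle, the homotopy identity loses its `K`-term and exhibits `m'` as `D₀ (H
  -- m')`. The entries of `H m'` are linear combinations of those of `m'`, so they stay in `I`.
  have h2 := congrArg (fun X => Matrix.mulVec X m') h
  simp only [Matrix.add_mulVec, ← Matrix.mulVec_mulVec, LinearMap.toMatrix'_mulVec, h1,
    Matrix.mulVec_zero, add_zero, Matrix.one_mulVec] at h2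
  have h3 (k) : H.mulVec m' k ∈ I :=
    Ideal.sum_mem _ fun k _ => I.mul_mem_left _ (hm _ _ _)
  refine ⟨_, _, fun p q => h3 (Sum.inl (p, q)), fun i j => h3 (Sum.inr (i, j)), fun i => ?_⟩
  ext p q
  exact (congrFun h2 (i, p, q)).symm

end Complex

/-! ### From vanishing Hochschild cohomology to a rigid frame over a field. -/

section Field

variable {n d : ℕ} {k : Type*} [Field k]

/-- Vanishing of `H¹(A, M_n(k)/A)` makes every normalized frame of `A` rigid. -/
lemma IsFrame.isRigidFrame {σ : Fin d → Fin n × Fin n}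
    {A : Subalgebra k (Matrix (Fin n) (Fin n) k)} {a : Fin d → Matrix (Fin n) (Fin n) k}
    (h : IsFrame σ A a) (hH : Subsingleton (HochschildH1 k A (QuotBimodule A))) :
    IsRigidFrame σ a := by
  -- Over a field, exactness in the middle already splits.
  suffices hex : ∀ v, diffOne σ a v = 0 → ∃ w, diffZero a w = v by
    obtain ⟨H, K, hHK⟩ := exists_homotopy_of_exact _ _ hex
    refine ⟨LinearMap.toMatrix' H, LinearMap.toMatrix' K, ?_⟩
    rw [← LinearMap.toMatrix'_comp, ← LinearMap.toMatrix'_comp, ← map_add, hHK,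
      LinearMap.toMatrix'_id]
  intro v hv
  let m : Fin d → Matrix (Fin n) (Fin n) k := fun i => Matrix.of fun p q => v (i, p, q)
  have ha (i : Fin d) : a i ∈ A := by
    have : a i ∈ Subalgebra.toSubmodule A := by rw [h.span]; exact Submodule.subset_span ⟨i, rfl⟩
    exact this
  have hmk (x : Matrix (Fin n) (Fin n) k) : QuotBimodule.mk A x = 0 ↔ x ∈ A :=
    Submodule.Quotient.mk_eq_zero _
  have hA (x : Matrix (Fin n) (Fin n) k) : x ∈ A ↔ reduceMod σ a x = 0 := by
    rw [reduceMod_eq_zero_iff h.delta, ← h.span, Subalgebra.mem_toSubmodule]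
  -- The `σ`-entries of `b` are its coordinates in the frame, so `f` is the linear map sending `a i`
  -- to the class of `m i`.
  let f : A →ₗ[k] QuotBimodule A :=
    { toFun b := QuotBimodule.mk A (∑ i, (b : Matrix _ _ k) (σ i).1 (σ i).2 • m i)
      map_add' b b' := by
        simp only [← map_add, ← Finset.sum_add_distrib, ← add_smul]
        rfl
      map_smul' c b := by
        simp only [← map_smul, Finset.smul_sum, smul_smul, RingHom.id_apply]
        rfl }
  have hfa (i : Fin d) : f ⟨a i, ha i⟩ = QuotBimodule.mk A (m i) := by
    change QuotBimodule.mk A (∑ j, a i (σ j).1 (σ j).2 • m j) = _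
    simp [h.delta]
  have hspan : Submodule.span k (Set.range fun i => (⟨a i, ha i⟩ : A)) = ⊤ := by
    rw [eq_top_iff]
    rintro ⟨b, hb⟩ -
    rw [Submodule.mem_span_range_iff_exists_fun]
    have hb' : b ∈ Submodule.span k (Set.range a) := by rw [← h.span]; exact hb
    obtain ⟨c, hc⟩ := (Submodule.mem_span_range_iff_exists_fun k).mp hb'
    refine ⟨c, Subtype.ext (Eq.trans ?_ hc)⟩
    simp
  have hf : f ∈ LinearMap.ker (hochschildD1 k A (QuotBimodule A)) := by
    rw [LinearMap.mem_ker]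
    -- The cocycle condition is bilinear, so it suffices to test it on pairs of frame elements.
    -- There it says that `derivationDefect` lies in `A`, which is the vanishing of `diffOne` on
    -- `v`.
    refine LinearMap.ext_on_range hspan fun i => LinearMap.ext_on_range hspan fun j => ?_
    change (⟨a i, ha i⟩ : A) • f ⟨a j, ha j⟩ - f (⟨a i, ha i⟩ * ⟨a j, ha j⟩) +
      MulOpposite.op (⟨a j, ha j⟩ : A) • f ⟨a i, ha i⟩ = 0
    rw [hfa, hfa, QuotBimodule.smul_mk, QuotBimodule.op_smul_mk]
    change QuotBimodule.mk A (a i * m j) - QuotBimodule.mk A _ + QuotBimodule.mk A (m i * a j) = 0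
    rw [← map_sub, ← map_add, hmk, sub_add_eq_add_sub, hA]
    ext p q
    exact congrFun hv (i, j, p, q)
  have hr : f ∈ LinearMap.range (hochschildD0 k A (QuotBimodule A)) := by
    have h1 := (Submodule.Quotient.subsingleton_iff.mp hH)
    have h2 : (⟨f, hf⟩ : LinearMap.ker (hochschildD1 k A (QuotBimodule A))) ∈
      (LinearMap.range (hochschildD0 k A (QuotBimodule A))).submoduleOf _ := by
      rw [h1]; trivial
    exact h2
  obtain ⟨q, hq⟩ := hr
  obtain ⟨x, rfl⟩ := QuotBimodule.mk_surjective A q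
  -- `f` is the inner derivation of the class of `x`, so `m i` and the bracket differ by an element
  -- of `A`; its coordinates in the frame are the `l`-part of the preimage.
  have h1 (i : Fin d) : ∃ l : Fin d → k, ∑ j, l j • a j = m i - (a i * x - x * a i) := by
    rw [← Submodule.mem_span_range_iff_exists_fun, ← h.span, Subalgebra.mem_toSubmodule, ← hmk,
      map_sub, sub_eq_zero, ← hfa, ← hq, map_sub]
    rfl
  choose l hl using h1
  refine ⟨Sum.elim (fun p => x p.1 p.2) (fun p => l p.1 p.2), ?_⟩
  funext ⟨i, p, q⟩
  have h2 : coboundary a x (Matrix.of l) i = m i := by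
    rw [coboundary]
    simp only [Matrix.of_apply]
    rw [hl, add_sub_cancel]
  exact congrFun (congrFun h2 p) q

end Field

/-! ### Conjugating algebras along square-zero extensions. -/

section Lifting

variable {n d : ℕ} {R R' : Type*} [CommRing R] [CommRing R']

/-- Conjugation `s ↦ g s g⁻¹` by an invertible matrix. -/
def unitConj (g : (Matrix (Fin n) (Fin n) R)ˣ) :
    Matrix (Fin n) (Fin n) R ≃ₐ[R] Matrix (Fin n) (Fin n) R :=
  AlgEquiv.ofLinearEquiv
    { toFun s := g.val * s * g⁻¹.val
      invFun s := g⁻¹.val * s * g.val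
      map_add' s t := by rw [mul_add, add_mul]
      map_smul' c s := by rw [mul_smul_comm, smul_mul_assoc]; rfl
      left_inv s := by simp only [mul_assoc, Units.inv_mul_cancel_left, Units.inv_mul, mul_one]
      right_inv s := by simp only [mul_assoc, Units.mul_inv_cancel_left, Units.mul_inv, mul_one] }
    (by
      change g.val * 1 * g⁻¹.val = 1
      rw [mul_one, Units.mul_inv])
    (fun s t => by
      change g.val * (s * t) * g⁻¹.val = g.val * s * g⁻¹.val * (g.val * t * g⁻¹.val)
      simp only [mul_assoc, Units.inv_mul_cancel_left])

lemma unitConj_apply (g : (Matrix (Fin n) (Fin n) R)ˣ) (s : Matrix (Fin n) (Fin n) R) :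
    unitConj g s = g.val * s * g⁻¹.val := rfl

lemma unitConj_symm_apply (g : (Matrix (Fin n) (Fin n) R)ˣ) (s : Matrix (Fin n) (Fin n) R) :
    (unitConj g).symm s = g⁻¹.val * s * g.val := rfl

lemma comap_unitConj_mul (A : Subalgebra R (Matrix (Fin n) (Fin n) R))
    (g h : (Matrix (Fin n) (Fin n) R)ˣ) :
    A.comap (unitConj (g * h)).toAlgHom =
      (A.comap (unitConj g).toAlgHom).comap (unitConj h).toAlgHom := by
  ext s
  change unitConj (g * h) s ∈ A ↔ unitConj g (unitConj h s) ∈ A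
  simp only [unitConj_apply, mul_inv_rev, Units.val_mul, mul_assoc]

lemma comap_unitConj_one (A : Subalgebra R (Matrix (Fin n) (Fin n) R)) :
    A.comap (unitConj 1).toAlgHom = A := by
  ext s
  change unitConj 1 s ∈ A ↔ _
  simp [unitConj_apply]

lemma extend_comap_unitConj (φ : R →+* R') (g : (Matrix (Fin n) (Fin n) R)ˣ)
    (A : Subalgebra R (Matrix (Fin n) (Fin n) R)) :
    extend φ (A.comap (unitConj g).toAlgHom) =
      (extend φ A).comap (unitConj (Units.map φ.mapMatrix.toMonoidHom g)).toAlgHom := by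
  apply Subalgebra.toSubmodule_injective
  have h : Subalgebra.toSubmodule A =
      Submodule.span R (Set.range (Subtype.val : A → Matrix (Fin n) (Fin n) R)) := by
    rw [Subtype.range_coe_subtype]
    exact (Submodule.span_eq (Subalgebra.toSubmodule A)).symm
  rw [toSubmodule_extend_of_span φ (toSubmodule_comap_of_span _ h),
    toSubmodule_comap_of_span _ (toSubmodule_extend_of_span φ h)]
  congr 2
  funext i
  simp only [unitConj_symm_apply, map_mul]
  rfl

/-- If `s` lifts the inverse, then `(r s - 1)² = 0`, which rearranges to `r · s (2 - r s) = 1`. The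
hypothesis `hI` says that the kernel of `φ` has square zero. -/
lemma isUnit_of_isUnit_map {φ : R →+* R'} (hφ : Function.Surjective φ)
    (hI : ∀ x y, φ x = 0 → φ y = 0 → x * y = 0) {r : R} (h : IsUnit (φ r)) : IsUnit r := by
  obtain ⟨s', hs⟩ := h.exists_right_inv
  obtain ⟨s, rfl⟩ := hφ s'
  have h1 : φ (r * s - 1) = 0 := by rw [map_sub, map_mul, hs, map_one, sub_self]
  have h2 := hI _ _ h1 h1
  exact IsUnit.of_mul_eq_one (s * (2 - r * s)) (by linear_combination -h2)

/-- Formal smoothness of `GL_n`: any lift of the entries works, since its determinant is a unit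
modulo the kernel. -/
lemma exists_unit_lift {φ : R →+* R'} (hφ : Function.Surjective φ)
    (hI : ∀ x y, φ x = 0 → φ y = 0 → x * y = 0) (g : (Matrix (Fin n) (Fin n) R')ˣ) :
    ∃ g₀ : (Matrix (Fin n) (Fin n) R)ˣ, Units.map φ.mapMatrix.toMonoidHom g₀ = g := by
  choose s hs using hφ
  let x : Matrix (Fin n) (Fin n) R := Matrix.of fun i j => s ((g : Matrix _ _ R') i j)
  have hx : φ.mapMatrix x = g := by
    ext i j
    exact hs _
  have hu : IsUnit x := by
    rw [Matrix.isUnit_iff_isUnit_det]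
    apply isUnit_of_isUnit_map (fun r => ⟨_, hs r⟩) hI
    rw [RingHom.map_det, hx, ← Matrix.isUnit_iff_isUnit_det]
    exact g.isUnit
  refine ⟨hu.unit, Units.ext ?_⟩
  exact hx

lemma matrix_mul_eq_zero {φ : R →+* R'} (hI : ∀ x y, φ x = 0 → φ y = 0 → x * y = 0)
    {x y : Matrix (Fin n) (Fin n) R} (hx : φ.mapMatrix x = 0) (hy : φ.mapMatrix y = 0) :
    x * y = 0 := by
  ext i j
  rw [Matrix.mul_apply]
  exact Finset.sum_eq_zero fun k _ =>
    hI _ _ (congrFun (congrFun hx i) k) (congrFun (congrFun hy k) j)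

lemma smul_matrix_eq_zero {φ : R →+* R'} (hI : ∀ x y, φ x = 0 → φ y = 0 → x * y = 0)
    {c : R} {y : Matrix (Fin n) (Fin n) R} (hc : φ c = 0) (hy : φ.mapMatrix y = 0) :
    c • y = 0 := by
  ext i j
  exact hI _ _ hc (congrFun (congrFun hy i) j)

/-- The difference of two normalized frames that agree modulo a square zero ideal is a
derivation. -/
lemma derivationDefect_sub {σ : Fin d → Fin n × Fin n} {φ : R →+* R'}
    (hI : ∀ x y, φ x = 0 → φ y = 0 → x * y = 0)
    {A B : Subalgebra R (Matrix (Fin n) (Fin n) R)} {a b : Fin d → Matrix (Fin n) (Fin n) R}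
    (ha : IsFrame σ A a) (hb : IsFrame σ B b)
    (hab : ∀ i, φ.mapMatrix (b i - a i) = 0) (i j : Fin d) :
    reduceMod σ a (derivationDefect σ a (fun i => b i - a i) i j) = 0 := by
  have mem {C : Subalgebra R (Matrix (Fin n) (Fin n) R)} {c : Fin d → Matrix (Fin n) (Fin n) R}
      (hc : IsFrame σ C c) (i : Fin d) : c i ∈ C := by
    have : c i ∈ Subalgebra.toSubmodule C := by
      rw [hc.span]; exact Submodule.subset_span ⟨i, rfl⟩
    exact this
  have expand {C : Subalgebra R (Matrix (Fin n) (Fin n) R)}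
      {c : Fin d → Matrix (Fin n) (Fin n) R} (hc : IsFrame σ C c) (i j : Fin d) :
      c i * c j = ∑ k, (c i * c j) (σ k).1 (σ k).2 • c k := by
    refine expand_of_mem_span hc.delta ?_
    rw [← hc.span]
    exact C.mul_mem (mem hc i) (mem hc j)
  let m : Fin d → Matrix (Fin n) (Fin n) R := fun i => b i - a i
  have hm (i : Fin d) : b i = a i + m i := (add_sub_cancel _ _).symm
  -- The first-order change of the product `a i * a j`; the second-order term `m i * m j` vanishes.
  let w := a i * m j + m i * a j
  have hw : φ.mapMatrix w = 0 := by
    simp only [w, map_add, map_mul]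
    rw [hab i, hab j, mul_zero, zero_mul, add_zero]
  have hbb : b i * b j = a i * a j + w := by
    have : m i * m j = 0 := matrix_mul_eq_zero hI (hab i) (hab j)
    rw [hm, hm, add_mul, mul_add, mul_add, this]
    simp only [w]
    abel
  have h1 := expand hb i j
  rw [hbb] at h1
  have h2 (k : Fin d) : (a i * a j + w) (σ k).1 (σ k).2 • b k =
      (a i * a j) (σ k).1 (σ k).2 • a k + (a i * a j) (σ k).1 (σ k).2 • m k +
        w (σ k).1 (σ k).2 • a k := by
    have : w (σ k).1 (σ k).2 • m k = 0 :=
      smul_matrix_eq_zero hI (congrFun (congrFun hw _) _) (hab k)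
    rw [hm, Matrix.add_apply, add_smul, smul_add, smul_add, this, add_zero]
  simp_rw [h2, Finset.sum_add_distrib] at h1
  rw [← expand ha i j, add_assoc] at h1
  -- Subtracting the expansion of `a i * a j` from that of `b i * b j` leaves the change of the
  -- structure constants, paired with the frame `a`; this lies in the span of `a`.
  have h3 : derivationDefect σ a m i j = ∑ k, w (σ k).1 (σ k).2 • a k := by
    rw [derivationDefect, sub_eq_iff_eq_add, add_comm (∑ k, w (σ k).1 (σ k).2 • a k)]
    exact add_left_cancel h1
  rw [reduceMod_eq_zero_iff ha.delta]
  change derivationDefect σ a m i j ∈ _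
  rw [h3]
  exact Submodule.sum_mem _ fun k _ => Submodule.smul_mem _ _ (Submodule.subset_span ⟨k, rfl⟩)

/-- Two algebras with normalized frames that agree modulo a square zero ideal are conjugate by a
matrix congruent to `1`, if one of the frames is rigid. -/
lemma exists_conj_of_congr {σ : Fin d → Fin n × Fin n} {φ : R →+* R'}
    (hI : ∀ x y, φ x = 0 → φ y = 0 → x * y = 0)
    {A B : Subalgebra R (Matrix (Fin n) (Fin n) R)} {a b : Fin d → Matrix (Fin n) (Fin n) R}
    (ha : IsFrame σ A a) (hr : IsRigidFrame σ a) (hb : IsFrame σ B b)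
    (hab : ∀ i, φ.mapMatrix (a i) = φ.mapMatrix (b i)) :
    ∃ g : (Matrix (Fin n) (Fin n) R)ˣ, Units.map φ.mapMatrix.toMonoidHom g = 1 ∧
      B = A.comap (unitConj g).toAlgHom := by
  have hab' (i : Fin d) : φ.mapMatrix (b i - a i) = 0 := by rw [map_sub, hab, sub_self]
  -- Rigidity is used with the ideal `ker φ`, so `x` and `l` again have entries in the kernel and
  -- all products of two such entries vanish.
  obtain ⟨x, l, hx, hl, hm⟩ := hr.exists_coboundary (RingHom.ker φ) (fun i => b i - a i)
    (fun i p q => congrFun (congrFun (hab' i) p) q) (derivationDefect_sub hI ha hb hab')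
  have hx' : φ.mapMatrix x = 0 := by
    ext p q
    exact hx p q
  have hxx : x * x = 0 := matrix_mul_eq_zero hI hx' hx'
  let g : (Matrix (Fin n) (Fin n) R)ˣ :=
    { val := 1 + x
      inv := 1 - x
      val_inv := by rw [add_mul, mul_sub, one_mul, mul_sub, mul_one, one_mul, hxx]; abel
      inv_val := by rw [sub_mul, mul_add, one_mul, mul_add, mul_one, one_mul, hxx]; abel }
  refine ⟨g, Units.ext ?_, ?_⟩
  · change φ.mapMatrix (1 + x) = 1
    rw [map_add, hx', map_one, add_zero]
  let c : Fin d → Matrix (Fin n) (Fin n) R := fun i => (unitConj g).symm (a i)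
  have hlb (i j : Fin d) : l i j • b j = l i j • a j := by
    rw [← sub_eq_zero, ← smul_sub]
    exact smul_matrix_eq_zero hI (hl i j) (hab' j)
  -- To first order `g⁻¹ a_i g` is `a_i + [a_i, x]`, which by the choice of `x` and `l` is `b_i - ∑
  -- l_ij a_j`. Replacing `a_j` by `b_j` costs nothing after multiplication by `l_ij`.
  have hc (i : Fin d) : c i = b i - ∑ j, l i j • b j := by
    have h1 : x * a i * x = 0 :=
      matrix_mul_eq_zero hI (by rw [map_mul, hx', zero_mul]) hx'
    have h2 : c i = a i + (a i * x - x * a i) := by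
      change (1 - x) * a i * (1 + x) = _
      rw [mul_add, mul_one, sub_mul, sub_mul, one_mul, h1]
      abel
    have h3 := hm i
    simp only [coboundary] at h3
    rw [h2, Finset.sum_congr rfl fun j _ => hlb i j, eq_sub_iff_add_eq, add_assoc, ← h3]
    abel
  -- Since `l² = 0`, the transition `1 - l` from `b` to `c` has inverse `1 + l`; hence `b` and `c`
  -- span the same module.
  have hlc (i : Fin d) : ∑ j, l i j • c j = ∑ j, l i j • b j := by
    refine Finset.sum_congr rfl fun j _ => ?_
    rw [hc, smul_sub, Finset.smul_sum, Finset.sum_eq_zero, sub_zero]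
    intro k _
    rw [smul_smul, hI _ _ (hl i j) (hl j k), zero_smul]
  apply Subalgebra.toSubmodule_injective
  rw [toSubmodule_comap_of_span _ ha.span, hb.span]
  change _ = Submodule.span R (Set.range c)
  have mem (v : Fin d → Matrix (Fin n) (Fin n) R) (i : Fin d) :
      v i ∈ Submodule.span R (Set.range v) := Submodule.subset_span ⟨i, rfl⟩
  apply le_antisymm
  · rw [Submodule.span_le]
    rintro _ ⟨i, rfl⟩
    have : b i = c i + ∑ j, l i j • c j := by rw [hlc, hc, sub_add_cancel]
    rw [this]
    exact Submodule.add_mem _ (mem c i)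
      (Submodule.sum_mem _ fun j _ => Submodule.smul_mem _ _ (mem c j))
  · rw [Submodule.span_le]
    rintro _ ⟨i, rfl⟩
    rw [hc]
    exact Submodule.sub_mem _ (mem b i)
      (Submodule.sum_mem _ fun j _ => Submodule.smul_mem _ _ (mem b j))

/-- Infinitesimal lifting for the orbit of an algebra with a rigid frame. -/
lemma exists_conj_lift {σ τ : Fin d → Fin n × Fin n} {φ : R →+* R'}
    (hφ : Function.Surjective φ) (hI : ∀ x y, φ x = 0 → φ y = 0 → x * y = 0)
    {A B : Subalgebra R (Matrix (Fin n) (Fin n) R)} {a b : Fin d → Matrix (Fin n) (Fin n) R}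
    (ha : IsFrame σ A a) (hr : IsRigidFrame σ a) (hb : IsFrame τ B b)
    (g : (Matrix (Fin n) (Fin n) R')ˣ)
    (h : extend φ B = (extend φ A).comap (unitConj g).toAlgHom) :
    ∃ g' : (Matrix (Fin n) (Fin n) R)ˣ, Units.map φ.mapMatrix.toMonoidHom g' = g ∧
      B = A.comap (unitConj g').toAlgHom := by
  obtain ⟨g₀, rfl⟩ := exists_unit_lift hφ hI g
  -- This is `g₀ B g₀⁻¹`, which agrees with `A` modulo the kernel, so the case of algebras congruent
  -- to each other applies.
  let B' := B.comap (unitConj g₀⁻¹).toAlgHom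
  have hB' : extend φ B' = extend φ A := by
    rw [extend_comap_unitConj, h, ← comap_unitConj_mul, map_inv, mul_inv_cancel,
      comap_unitConj_one]
  have hspan := toSubmodule_comap_of_span (unitConj g₀⁻¹) hb.span
  have hspan' := toSubmodule_extend_of_span φ hspan
  change Subalgebra.toSubmodule (extend φ B') = _ at hspan'
  rw [hB'] at hspan'
  have hu := isUnit_det_of_isFrame (ha.extend φ) hspan'
  -- The frame of `B` was normalized at `τ`, but a comparison with `a` needs positions `σ`. The
  -- minor at `σ` is a unit modulo the kernel because `A` has a frame there, hence it is a unit.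
  -- Uniqueness of normalized frames then makes the two reductions equal.
  have hb' := exists_isFrame (σ := σ) hspan (isUnit_of_isUnit_map hφ hI (by
    rw [RingHom.map_det]
    exact hu))
  obtain ⟨g₁, hg₁, hA⟩ := exists_conj_of_congr hI ha hr hb' fun i => by
    have h1 := hb'.extend φ
    change IsFrame σ (extend φ B') _ at h1
    rw [hB'] at h1
    exact congrFun ((ha.extend φ).unique h1) i
  refine ⟨g₁ * g₀, by rw [map_mul, hg₁, one_mul], ?_⟩
  rw [comap_unitConj_mul, ← hA, ← comap_unitConj_mul, inv_mul_cancel, comap_unitConj_one]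

end Lifting

/-! ### From lifting of points to formal smoothness of rings. -/

section FormallySmooth

/-- A morphism with the infinitesimal lifting property is formally smooth on affine opens. -/
lemma formallySmooth_appLE {X Y : Scheme.{u}} (f : X ⟶ Y) {U : Y.Opens} (hU : IsAffineOpen U)
    {V : X.Opens} (hV : IsAffineOpen V) (e : V ≤ f ⁻¹ᵁ U)
    (H : ∀ (R R' : CommRingCat.{u}) (φ : R ⟶ R'), Function.Surjective φ →
      (∀ x y, φ x = 0 → φ y = 0 → x * y = 0) → ∀ (t : Spec R ⟶ Y) (z : Spec R' ⟶ X),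
      (∀ x, t x ∈ U) → z ≫ f = Spec.map φ ≫ t →
      ∃ l : Spec R ⟶ X, Spec.map φ ≫ l = z ∧ l ≫ f = t) :
    (f.appLE U V e).hom.FormallySmooth := by
  algebraize [(f.appLE U V e).hom]
  rw [RingHom.FormallySmooth]
  refine Algebra.FormallySmooth.of_comp_surjective fun B _ _ I hI g => ?_
  let φ : CommRingCat.of B ⟶ CommRingCat.of (B ⧸ I) := CommRingCat.ofHom (Ideal.Quotient.mk I)
  let γ : Γ(X, V) ⟶ CommRingCat.of (B ⧸ I) := CommRingCat.ofHom g.toRingHom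
  let β : Γ(Y, U) ⟶ CommRingCat.of B := CommRingCat.ofHom (algebraMap Γ(Y, U) B)
  have hφ : Function.Surjective φ := Ideal.Quotient.mk_surjective
  have hφ0 (x : B) (hx : φ x = 0) : x ∈ I := Ideal.Quotient.eq_zero_iff_mem.mp hx
  have hsq : f.appLE U V e ≫ γ = β ≫ φ := by
    ext x
    exact g.commutes x
  have hw : (Spec.map γ ≫ hV.fromSpec) ≫ f = Spec.map φ ≫ Spec.map β ≫ hU.fromSpec := by
    rw [Category.assoc, ← IsAffineOpen.SpecMap_appLE_fromSpec f hU hV e, ← Spec.map_comp_assoc, hsq,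
      Spec.map_comp_assoc]
  obtain ⟨l, hl, hl'⟩ := H _ _ φ hφ (fun x y hx hy => by
      have := Ideal.mul_mem_mul (hφ0 x hx) (hφ0 y hy)
      rw [← pow_two, hI] at this
      exact this) (Spec.map β ≫ hU.fromSpec) (Spec.map γ ≫ hV.fromSpec) (fun x => by
      have : hU.fromSpec (Spec.map β x) ∈ Set.range hU.fromSpec := ⟨_, rfl⟩
      rw [hU.range_fromSpec] at this
      rwa [Scheme.Hom.comp_apply]) hw
  -- An ideal of square zero lies in every prime, so `Spec (B ⧸ I)` has the same points as `Spec B`.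
  have hsurj : Function.Surjective (Spec.map φ) := by
    intro x
    have h1 : RingHom.ker φ.hom ≤ x.asIdeal := by
      intro r hr
      have := Ideal.mul_mem_mul (hφ0 r hr) (hφ0 r hr)
      rw [← pow_two I, hI] at this
      have h0 : r * r = 0 := this
      exact (or_self_iff.mp (x.isPrime.mem_or_mem (h0 ▸ x.asIdeal.zero_mem)))
    have h2 : x ∈ Set.range (PrimeSpectrum.comap φ.hom) := by
      rw [range_comap_of_surjective _ _ hφ]
      exact h1
    exact h2
  -- The lift `l` only goes to `X`. That it stays in `V` is a condition on points, so it can be read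
  -- off from `z`, which factors through `V`.
  have hrange : Set.range l ⊆ Set.range hV.fromSpec := by
    rintro _ ⟨x, rfl⟩
    obtain ⟨y, rfl⟩ := hsurj x
    rw [← Scheme.Hom.comp_apply, hl, Scheme.Hom.comp_apply]
    exact ⟨_, rfl⟩
  let ψ : Γ(X, V) ⟶ CommRingCat.of B := Spec.preimage (IsOpenImmersion.lift hV.fromSpec l hrange)
  have hψ : Spec.map ψ ≫ hV.fromSpec = l := by
    rw [Spec.map_preimage, IsOpenImmersion.lift_fac]
  have h1 : f.appLE U V e ≫ ψ = β := by
    apply Spec.map_injective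
    rw [← cancel_mono hU.fromSpec, Spec.map_comp_assoc,
      IsAffineOpen.SpecMap_appLE_fromSpec f hU hV e, reassoc_of% hψ, hl']
  have h2 : ψ ≫ φ = γ := by
    apply Spec.map_injective
    rw [← cancel_mono hV.fromSpec, Spec.map_comp_assoc, hψ, hl]
  refine ⟨{ ψ.hom with commutes' := fun r => ?_ }, ?_⟩
  · exact ConcreteCategory.congr_hom h1 r
  · ext x
    exact ConcreteCategory.congr_hom h2 x

end FormallySmooth

/-! ### Points of `GL_n` as invertible matrices. -/

section GeneralLinear

variable {n d : ℕ}

/-- The scheme `GL_n` over `ℤ`. -/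
noncomputable def glScheme (n : ℕ) : Scheme.{u} :=
  Spec (CommRingCat.of (Localization.Away (genericMatrix.{u} n).det))

/-- The projection from `GL_n` to `PGL_n`. -/
noncomputable def glToPGL (n : ℕ) : glScheme.{u} n ⟶ PGL.{u} n :=
  Spec.map (CommRingCat.ofHom (inclLoc.{u} n))

/-- The invertible matrix over `R` attached to an `R`-valued point of `GL_n`. -/
noncomputable def glUnit {R : Type*} [CommRing R]
    (ψ : Localization.Away (genericMatrix.{u} n).det →+* R) : (Matrix (Fin n) (Fin n) R)ˣ :=
  Units.map ψ.mapMatrix.toMonoidHom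
    ⟨locMatrix n, (locMatrix n)⁻¹, Matrix.mul_nonsing_inv _ isUnit_det_locMatrix,
      Matrix.nonsing_inv_mul _ isUnit_det_locMatrix⟩

variable {R R' : Type*} [CommRing R] [CommRing R']

lemma glUnit_comp (φ : R →+* R') (ψ : Localization.Away (genericMatrix.{u} n).det →+* R) :
    glUnit (φ.comp ψ) = Units.map φ.mapMatrix.toMonoidHom (glUnit ψ) := rfl

lemma glUnit_injective :
    Function.Injective (glUnit (n := n) (R := R) :
      (Localization.Away (genericMatrix.{u} n).det →+* R) → (Matrix (Fin n) (Fin n) R)ˣ) := by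
  intro ψ ψ' h
  apply IsLocalization.ringHom_ext (Submonoid.powers (genericMatrix.{u} n).det)
  apply MvPolynomial.ringHom_ext
  · intro r
    obtain ⟨r⟩ := r
    -- Constants are integer casts, on which all ring homomorphisms agree.
    have : (ULift.up r : ULift.{u} ℤ) = (r : ULift.{u} ℤ) := rfl
    rw [this]
    simp
  · rintro ⟨i, j⟩
    have h1 := congrArg (fun g : (Matrix (Fin n) (Fin n) R)ˣ => g.val i j) h
    change ψ (locMatrix n i j) = ψ' (locMatrix n i j) at h1
    simpa [locMatrix, Matrix.mvPolynomialX] using h1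

lemma glUnit_surjective :
    Function.Surjective (glUnit (n := n) (R := R) :
      (Localization.Away (genericMatrix.{u} n).det →+* R) → (Matrix (Fin n) (Fin n) R)ˣ) := by
  intro g
  let ψ₀ : MvPolynomial (Fin n × Fin n) (ULift.{u} ℤ) →+* R :=
    MvPolynomial.eval₂Hom ((Int.castRingHom R).comp (ULift.ringEquiv : ULift.{u} ℤ ≃+* ℤ))
      (fun x => g.val x.1 x.2)
  have h0 : ψ₀.mapMatrix (genericMatrix.{u} n) = g.val := by
    ext i j
    simp [ψ₀, Matrix.mvPolynomialX]
  have hu : IsUnit (ψ₀ (genericMatrix.{u} n).det) := by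
    rw [RingHom.map_det, h0, ← Matrix.isUnit_iff_isUnit_det]
    exact g.isUnit
  refine ⟨IsLocalization.Away.lift _ hu, Units.ext ?_⟩
  rw [← h0]
  ext i j
  exact IsLocalization.Away.lift_eq _ hu _

/-- The gain from pulling back to `GL_n`: the action defined by the coordinates of `PGL_n` becomes
conjugation by an actual matrix. -/
lemma conjEquiv_comp_inclLoc (ψ : Localization.Away (genericMatrix.{u} n).det →+* R) :
    conjEquiv (ψ.comp (inclLoc n)) = unitConj (glUnit ψ) := by
  ext1 s
  exact conjEquiv_of_lift ψ s

lemma homOfSpec_comp_glToPGL {X : Scheme.{u}} (P : X ⟶ glScheme.{u} n) :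
    homOfSpec (R := CommRingCat.of (PGLRing.{u} n)) (P ≫ glToPGL n) =
      (homOfSpec (R := CommRingCat.of (Localization.Away (genericMatrix.{u} n).det)) P).comp
        (inclLoc n) := by
  have h : (Scheme.ΓSpecIso _).inv ≫ (P ≫ glToPGL n).appTop =
      CommRingCat.ofHom (inclLoc.{u} n) ≫ (Scheme.ΓSpecIso _).inv ≫ P.appTop := by
    rw [Scheme.Hom.comp_appTop]
    exact (Scheme.ΓSpecIso_inv_naturality_assoc (CommRingCat.ofHom (inclLoc.{u} n)) P.appTop).symm
  exact congrArg CommRingCat.Hom.hom h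

/-- The invertible matrix of global functions attached to a morphism to `GL_n`. -/
noncomputable def glPoint {X : Scheme.{u}} (P : X ⟶ glScheme.{u} n) :
    (Matrix (Fin n) (Fin n) Γ(X, ⊤))ˣ :=
  glUnit (homOfSpec (R := CommRingCat.of (Localization.Away (genericMatrix.{u} n).det)) P)

lemma glPoint_comp {X Y : Scheme.{u}} (f : Y ⟶ X) (P : X ⟶ glScheme.{u} n) :
    glPoint (f ≫ P) = Units.map f.appTop.hom.mapMatrix.toMonoidHom (glPoint P) := by
  rw [glPoint, glPoint, ← glUnit_comp]
  exact congrArg glUnit (homOfSpec_comp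
    (R := CommRingCat.of (Localization.Away (genericMatrix.{u} n).det)) f P)

lemma glPoint_injective {X : Scheme.{u}} :
    Function.Injective (glPoint : (X ⟶ glScheme.{u} n) → (Matrix (Fin n) (Fin n) Γ(X, ⊤))ˣ) :=
  fun _ _ h => homOfSpec_injective
    (R := CommRingCat.of (Localization.Away (genericMatrix.{u} n).det)) (glUnit_injective h)

lemma glPoint_surjective {X : Scheme.{u}} :
    Function.Surjective (glPoint : (X ⟶ glScheme.{u} n) → (Matrix (Fin n) (Fin n) Γ(X, ⊤))ˣ) := by
  intro g
  obtain ⟨ψ, rfl⟩ := glUnit_surjective.{u} g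
  obtain ⟨P, rfl⟩ := exists_homOfSpec
    (R := CommRingCat.of (Localization.Away (genericMatrix.{u} n).det)) ψ
  exact ⟨P, rfl⟩

end GeneralLinear

/-! ### Frames of sections, and spreading out rigidity. -/

section LocalFrames

variable {n d : ℕ} {σ : Fin d → Fin n × Fin n} {X Y : Scheme.{u}}

/-- Sections over `U` that form a normalized frame of the mold at each point of `U`. -/
def IsFrameOn (A : Mold n d X) (σ : Fin d → Fin n × Fin n) (U : X.Opens)
    (a : Fin d → Matrix (Fin n) (Fin n) Γ(X, U)) : Prop :=
  ∀ (y : X) (hy : y ∈ U),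
    IsFrame σ (A.stalk y) (fun i => (X.presheaf.germ U y hy).hom.mapMatrix (a i))

lemma IsFrameOn.defect_eq_zero {A : Mold n d X} {U : X.Opens}
    {a : Fin d → Matrix (Fin n) (Fin n) Γ(X, U)} (h : IsFrameOn A σ U a) (x) :
    defect σ a x = 0 := by
  apply TopCat.Presheaf.section_ext X.sheaf U
  intro y hy
  change (X.presheaf.germ U y hy).hom _ = (X.presheaf.germ U y hy).hom _
  rw [map_defect, (h y hy).defect_eq_zero, map_zero]

lemma IsFrameOn.restrict {A : Mold n d X} {U V : X.Opens}
    {a : Fin d → Matrix (Fin n) (Fin n) Γ(X, U)} (h : IsFrameOn A σ U a) (hle : V ≤ U) :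
    IsFrameOn A σ V (fun i => (X.presheaf.map (homOfLE hle).op).hom.mapMatrix (a i)) := by
  intro y hy
  convert h y (hle hy) using 1
  funext i
  ext p q
  exact X.presheaf.germ_res_apply (homOfLE hle) y hy _

lemma IsFrameOn.pullback {A : Mold n d X} {U : X.Opens}
    {a : Fin d → Matrix (Fin n) (Fin n) Γ(X, U)} (h : IsFrameOn A σ U a) (f : Y ⟶ X)
    (V : Y.Opens) (e : V ≤ f ⁻¹ᵁ U) :
    IsFrameOn (A.pullback f) σ V (fun i => (f.appLE U V e).hom.mapMatrix (a i)) := by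
  intro y hy
  convert (h (f y) (e hy)).extend (f.stalkMap y).hom using 1
  · rfl
  funext i
  ext p q
  have h1 : f.appLE U V e ≫ Y.presheaf.germ V y hy =
      X.presheaf.germ U (f y) (e hy) ≫ f.stalkMap y := by
    refine Eq.trans ?_ (Scheme.Hom.germ_stalkMap f U y (e hy)).symm
    rw [Scheme.Hom.appLE, Category.assoc, Y.presheaf.germ_res]
  exact ConcreteCategory.congr_hom h1 (a i p q)

/-- A mold with normalized frames at all points has a global normalized frame. -/
lemma exists_isFrameOn_top (A : Mold n d X) (h : ∀ x, ∃ a, IsFrame σ (A.stalk x) a) :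
    ∃ a, IsFrameOn A σ ⊤ a := by
  -- Normalized frames are unique, so local ones glue; the morphism to the chart records the result,
  -- and the universal frame pulls back to it.
  obtain ⟨g, rfl⟩ := exists_chart_hom A h
  exact ⟨_, fun y _ => isFrame_pullback_chartMold g y⟩

/-- With a global frame the mold comes from one algebra over the ring of global sections, and
infinitesimal lifting becomes pure algebra. -/
lemma IsFrameOn.stalk_eq {A : Mold n d X} {a : Fin d → Matrix (Fin n) (Fin n) Γ(X, ⊤)}
    (h : IsFrameOn A σ ⊤ a) (x : X) :
    A.stalk x = extend (germTop X x) (frameAlgebra a h.defect_eq_zero) := by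
  apply Subalgebra.toSubmodule_injective
  rw [(h x trivial).span, ((isFrame_frameAlgebra a h.defect_eq_zero).extend _).span]

/-- Finitely many germs at a point come from sections over a common neighbourhood. -/
lemma exists_germ_family {ι : Type*} [Finite ι] {x : X} {U : X.Opens} (hx : x ∈ U)
    (s : ι → X.presheaf.stalk x) :
    ∃ (V : X.Opens) (_ : V ≤ U) (hV : x ∈ V) (r : ι → Γ(X, V)),
      ∀ i, (X.presheaf.germ V x hV).hom (r i) = s i := by
  choose W hW r hr using fun i => TopCat.Presheaf.exists_germ_eq X.presheaf (s i)
  let V : X.Opens := ⟨(⋂ i, (W i : Set X)) ∩ U,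
    (isOpen_iInter_of_finite fun i => (W i).2).inter U.2⟩
  have hVW (i : ι) : V ≤ W i := fun y hy => Set.mem_iInter.mp hy.1 i
  have hV : x ∈ V := ⟨Set.mem_iInter.mpr hW, hx⟩
  refine ⟨V, fun y hy => hy.2, hV, fun i => (X.presheaf.map (homOfLE (hVW i)).op).hom (r i),
    fun i => ?_⟩
  rw [← hr i]
  exact X.presheaf.germ_res_apply (homOfLE (hVW i)) x hV _

/-- Around a point where `H¹` vanishes, a mold has a rigid frame. -/
lemma exists_isRigidFrame (A : Mold n d X) (x : X)
    (hx : Subsingleton (HochschildH1 (X.residueField x) (A.fiber x)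
      (QuotBimodule (A.fiber x)))) :
    ∃ (τ : Fin d → Fin n × Fin n) (U : X.Opens) (_ : x ∈ U)
      (a : Fin d → Matrix (Fin n) (Fin n) Γ(X, U)), IsFrameOn A τ U a ∧ IsRigidFrame τ a := by
  obtain ⟨τ, hτ⟩ := exists_mem_frameLocus A x
  obtain ⟨U, hU, a, ha⟩ := exists_local_frame A x hτ
  replace ha : IsFrameOn A τ U a := ha
  obtain ⟨H, K, hHK⟩ := ((ha x hU).extend (X.residue x).hom).isRigidFrame hx
  -- The entries of the homotopy over `k(x)` are lifted to germs and then to sections over a common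
  -- neighbourhood; the second shrinking keeps the `H`-entries by restriction.
  choose s hs using Scheme.residue_surjective X x
  obtain ⟨V₁, hV₁, hx₁, H', hH'⟩ := exists_germ_family hU (fun p : _ × _ => s (H p.1 p.2))
  obtain ⟨V, hV, hxV, K', hK'⟩ := exists_germ_family hx₁ (fun p : _ × _ => s (K p.1 p.2))
  let γ : Γ(X, V) →+* X.residueField x := (X.residue x).hom.comp (X.presheaf.germ V x hxV).hom
  let a' : Fin d → Matrix (Fin n) (Fin n) Γ(X, V) :=
    fun i => (X.presheaf.map (homOfLE (hV.trans hV₁)).op).hom.mapMatrix (a i)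
  have ha' : IsFrameOn A τ V a' := ha.restrict _
  let H₁ : Matrix _ _ Γ(X, V) :=
    Matrix.of fun i j => (X.presheaf.map (homOfLE hV).op).hom (H' (i, j))
  let K₁ : Matrix _ _ Γ(X, V) := Matrix.of fun i j => K' (i, j)
  have hH₁ : H₁.map γ = H := by
    ext i j
    have h1 : (X.presheaf.germ V x hxV).hom ((X.presheaf.map (homOfLE hV).op).hom (H' (i, j))) =
        s (H i j) := (X.presheaf.germ_res_apply (homOfLE hV) x hxV _).trans (hH' (i, j))
    exact (congrArg (X.residue x).hom h1).trans (hs _)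
  have hK₁ : K₁.map γ = K := by
    ext i j
    exact (congrArg (X.residue x).hom (hK' (i, j))).trans (hs _)
  have haγ : (fun i => γ.mapMatrix (a' i)) = fun i => (X.residue x).hom.mapMatrix
      ((X.presheaf.germ U x hU).hom.mapMatrix (a i)) := by
    funext i
    ext p q
    exact congrArg (X.residue x).hom
      (X.presheaf.germ_res_apply (homOfLE (hV.trans hV₁)) x hxV (a i p q))
  -- The lifted homotopy equals `1` only at `x`. Its determinant is therefore a unit near `x`, and
  -- on that open set `exists_homotopy_of_isUnit_det` corrects it to an exact homotopy.
  let u := LinearMap.toMatrix' (diffZero a') * H₁ + K₁ * LinearMap.toMatrix' (diffOne τ a')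
  have hu : u.map γ = 1 := by
    rw [← hHK, ← haγ, toMatrix_diffZero_map, toMatrix_diffOne_map, ← hH₁, ← hK₁,
      ← Matrix.map_mul, ← Matrix.map_mul, ← Matrix.map_add γ (map_add γ)]
  have hdet : γ u.det = 1 := by
    rw [RingHom.map_det, RingHom.mapMatrix_apply, hu, Matrix.det_one]
  have : IsLocalHom (X.residue x).hom := inferInstanceAs (IsLocalHom (IsLocalRing.residue _))
  have hxW : x ∈ X.basicOpen u.det := by
    rw [X.mem_basicOpen u.det x hxV, ← isUnit_map_iff (X.residue x).hom]
    change IsUnit (γ u.det)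
    rw [hdet]
    exact isUnit_one
  have hle : X.basicOpen u.det ≤ V := X.basicOpen_le u.det
  let ρ : Γ(X, V) →+* Γ(X, X.basicOpen u.det) := (X.presheaf.map (homOfLE hle).op).hom
  have hW : IsFrameOn A τ (X.basicOpen u.det) (fun i => ρ.mapMatrix (a' i)) := ha'.restrict hle
  refine ⟨τ, _, hxW, _, hW, ?_⟩
  refine exists_homotopy_of_isUnit_det
    (toMatrix_diffOne_mul_diffZero (isFrame_frameAlgebra _ hW.defect_eq_zero))
    (H := H₁.map ρ) (K := K₁.map ρ) ?_
  rw [toMatrix_diffZero_map, toMatrix_diffOne_map, ← Matrix.map_mul, ← Matrix.map_mul,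
    ← Matrix.map_add ρ (map_add ρ)]
  change IsUnit (ρ.mapMatrix u).det
  rw [← RingHom.map_det]
  exact X.toRingedSpace.isUnit_res_basicOpen u.det

/-- An algebra of global matrices with a normalized frame is determined by its stalks among the
algebras spanned by `d` elements. -/
lemma eq_of_extend_germTop {N N' : Subalgebra Γ(X, ⊤) (Matrix (Fin n) (Fin n) Γ(X, ⊤))}
    {b c : Fin d → Matrix (Fin n) (Fin n) Γ(X, ⊤)} (hb : IsFrame σ N b)
    (hc : Subalgebra.toSubmodule N' = Submodule.span Γ(X, ⊤) (Set.range c))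
    (h : ∀ x, extend (germTop X x) N = extend (germTop X x) N') : N = N' := by
  -- Invertibility of the minor can be tested on stalks, where the two algebras coincide and a frame
  -- normalized at `σ` exists. The two normalized frames then have equal germs.
  have hu : IsUnit (Matrix.det (Matrix.of fun i k : Fin d => c i (σ k).1 (σ k).2)) := by
    refine X.toRingedSpace.isUnit_of_isUnit_germ ⊤ _ fun x _ => ?_
    change IsUnit (germTop X x _)
    rw [RingHom.map_det]
    refine isUnit_det_of_isFrame (b := fun i => (germTop X x).mapMatrix (c i))
      (hb.extend (germTop X x)) ?_
    rw [h, toSubmodule_extend_of_span _ hc]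
  have hc' := exists_isFrame hc hu
  apply Subalgebra.toSubmodule_injective
  rw [hb.span, hc'.span]
  congr 2
  funext i
  ext p q
  apply eq_of_germTop
  intro x
  have h1 := hb.extend (germTop X x)
  rw [h] at h1
  exact congrFun (congrFun (congrFun (h1.unique (hc'.extend (germTop X x))) i) p) q

end LocalFrames

/-! ### Infinitesimal lifting for the orbit map. -/

section OrbitLifting

variable {n d : ℕ}

/-- The universal mold on `Mold_{n,d}`. -/
noncomputable def univMold (n d : ℕ) : Mold n d (moldScheme.{u} n d) :=
  (moldFunctor.{u} n d).representableBy.homEquiv (𝟙 _)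

lemma classify_univMold : classify (univMold.{u} n d) = 𝟙 _ :=
  (moldFunctor.{u} n d).representableBy.homEquiv.symm_apply_apply _

lemma classify_pullback_univMold {X : Scheme.{u}} (g : X ⟶ moldScheme.{u} n d) :
    classify ((univMold n d).pullback g) = g := by
  rw [← comp_classify, classify_univMold, Category.comp_id]

lemma classify_injective {X : Scheme.{u}} :
    Function.Injective (classify : Mold n d X → (X ⟶ moldScheme.{u} n d)) :=
  (moldFunctor.{u} n d).representableBy.homEquiv.symm.injective

/-- The base change `GL_{n,S} = GL_n ⊗_ℤ S`. -/
noncomputable abbrev GLOver (n : ℕ) (S : Scheme.{u}) : Scheme.{u} :=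
  Limits.pullback (terminal.from (glScheme.{u} n)) (terminal.from S)

/-- The projection `GL_{n,S} ⟶ PGL_{n,S}`. -/
noncomputable def glOverToPGLOver (n : ℕ) (S : Scheme.{u}) : GLOver.{u} n S ⟶ PGLOver.{u} n S :=
  pullback.lift (pullback.fst _ _ ≫ glToPGL n) (pullback.snd _ _) (terminal.hom_ext _ _)

/-- Turns equations between morphisms into `Mold_{n,d} ⊗ S` into equations between molds and between
morphisms to `S`. -/
lemma comp_glOverToPGLOver_orbitMap {S X : Scheme.{u}} (A : Mold n d S) (z : X ⟶ GLOver.{u} n S) :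
    z ≫ glOverToPGLOver n S ≫ orbitMap A =
      pullback.lift (classify ((A.pullback (z ≫ pullback.snd _ _)).conj
        ((z ≫ pullback.fst _ _) ≫ glToPGL n))) (z ≫ pullback.snd _ _)
        (terminal.hom_ext _ _) := by
  rw [← lift_orbitMap, ← Category.assoc]
  congr 1
  apply pullback.hom_ext
  · rw [Category.assoc, glOverToPGLOver, pullback.lift_fst, pullback.lift_fst, Category.assoc]
  · rw [Category.assoc, glOverToPGLOver, pullback.lift_snd, pullback.lift_snd]

lemma stalk_conj_glToPGL {X : Scheme.{u}} (A : Mold n d X) (P : X ⟶ glScheme.{u} n)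
    {N : Subalgebra Γ(X, ⊤) (Matrix (Fin n) (Fin n) Γ(X, ⊤))}
    (hN : ∀ x, A.stalk x = extend (germTop X x) N) (x : X) :
    (A.conj (P ≫ glToPGL n)).stalk x = extend (germTop X x)
      (N.comap (unitConj (glPoint P)).toAlgHom) := by
  rw [glPoint, ← conjEquiv_comp_inclLoc, extend_comap_conj, ← hN, ← homOfSpec_comp_glToPGL]
  rfl

lemma stalk_pullback {X Y : Scheme.{u}} (f : Y ⟶ X) (A : Mold n d X)
    {N : Subalgebra Γ(X, ⊤) (Matrix (Fin n) (Fin n) Γ(X, ⊤))}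
    (hN : ∀ x, A.stalk x = extend (germTop X x) N) (y : Y) :
    (A.pullback f).stalk y = extend (germTop Y y) (extend f.appTop.hom N) := by
  rw [← extend_comp, ← stalkMap_germTop, extend_comp, ← hN]
  rfl

/-- Infinitesimal lifting for `GL_{n,S} ⟶ Mold_{n,d} ⊗ S` in the presence of global frames. -/
lemma exists_lift_orbitMap {S X X' : Scheme.{u}} (A : Mold n d S) (j : X' ⟶ X)
    (hj : Function.Surjective j.appTop.hom)
    (hI : ∀ x y, j.appTop.hom x = 0 → j.appTop.hom y = 0 → x * y = 0)
    (t : X ⟶ MoldOver.{u} n d S) (z : X' ⟶ GLOver.{u} n S)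
    (hz : z ≫ glOverToPGLOver n S ≫ orbitMap A = j ≫ t)
    {σ τ : Fin d → Fin n × Fin n} {a b : Fin d → Matrix (Fin n) (Fin n) Γ(X, ⊤)}
    (ha : IsFrameOn (A.pullback (t ≫ pullback.snd _ _)) σ ⊤ a) (hr : IsRigidFrame σ a)
    (hb : IsFrameOn ((univMold n d).pullback (t ≫ pullback.fst _ _)) τ ⊤ b) :
    ∃ l : X ⟶ GLOver.{u} n S, j ≫ l = z ∧ l ≫ glOverToPGLOver n S ≫ orbitMap A = t := by
  let s : X ⟶ S := t ≫ pullback.snd _ _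
  let A' := A.pullback s
  let B := (univMold n d).pullback (t ≫ pullback.fst _ _)
  let N := frameAlgebra a ha.defect_eq_zero
  let N' := frameAlgebra b hb.defect_eq_zero
  have hA (x : X) : A'.stalk x = extend (germTop X x) N := ha.stalk_eq x
  have hB (x : X) : B.stalk x = extend (germTop X x) N' := hb.stalk_eq x
  have hNa := isFrame_frameAlgebra a ha.defect_eq_zero
  have hNb := isFrame_frameAlgebra b hb.defect_eq_zero
  have hzs : z ≫ pullback.snd _ _ = j ≫ s := by
    have := congrArg (fun f => f ≫ pullback.snd _ _) hz
    rw [comp_glOverToPGLOver_orbitMap] at this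
    simpa only [pullback.lift_snd, Category.assoc] using this
  let P₀ : X' ⟶ glScheme.{u} n := z ≫ pullback.fst _ _
  -- The first component of `hz`, read as an equality of molds on `X'`: `P₀` conjugates the
  -- restriction of `A'` into that of `B`.
  have hzB : (A'.pullback j).conj (P₀ ≫ glToPGL n) = B.pullback j := by
    have := congrArg (fun f => f ≫ pullback.fst _ _) hz
    rw [comp_glOverToPGLOver_orbitMap] at this
    simp only [pullback.lift_fst] at this
    apply classify_injective
    rw [← comp_classify j B, classify_pullback_univMold, ← Category.assoc, ← this, hzs,
      Mold.pullback_comp]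
  -- Molds agree stalkwise; `eq_of_extend_germTop` upgrades this to the algebras over `Γ(X', ⊤)`,
  -- the form required by `exists_conj_lift`.
  have hext : extend j.appTop.hom N' =
      (extend j.appTop.hom N).comap (unitConj (glPoint P₀)).toAlgHom := by
    refine eq_of_extend_germTop (hNb.extend j.appTop.hom)
      (toSubmodule_comap_of_span _ (hNa.extend j.appTop.hom).span) fun x => ?_
    rw [← stalk_pullback j B hB, ← hzB, stalk_conj_glToPGL _ P₀ (stalk_pullback j A' hA)]
  obtain ⟨g', hg', hconj⟩ := exists_conj_lift hj hI hNa hr hNb _ hext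
  obtain ⟨P, rfl⟩ := glPoint_surjective g'
  let l : X ⟶ GLOver.{u} n S := pullback.lift P s (terminal.hom_ext _ _)
  have hl₁ : l ≫ pullback.fst _ _ = P := pullback.lift_fst _ _ _
  have hl₂ : l ≫ pullback.snd _ _ = s := pullback.lift_snd _ _ _
  refine ⟨l, pullback.hom_ext ?_ ?_, ?_⟩
  · rw [Category.assoc, hl₁]
    apply glPoint_injective
    rw [glPoint_comp]
    exact hg'
  · rw [Category.assoc, hl₂, hzs]
  · rw [comp_glOverToPGLOver_orbitMap, hl₁, hl₂]
    have hm : (A.pullback s).conj (P ≫ glToPGL n) = B := by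
      apply Mold.ext
      funext x
      rw [stalk_conj_glToPGL A' P hA, hB]
      exact congrArg _ hconj.symm
    rw [hm]
    apply pullback.hom_ext
    · rw [pullback.lift_fst, classify_pullback_univMold]
    · rw [pullback.lift_snd]

end OrbitLifting

/-! ### Surjectivity of `GL_n → PGL_n`. -/

section Surjectivity

variable (n : ℕ)

/-- A point of the degree zero localization is a homogeneous prime not containing the determinant,
and that prime generates a prime of the full localization lying over the point. -/
lemma comap_inclLoc_surjective : Function.Surjective (PrimeSpectrum.comap (inclLoc.{u} n)) := by
  intro q
  rcases Nat.eq_zero_or_pos n with rfl | hn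
  -- For `n = 0` the determinant has degree zero and the description by `Proj` is not available. But
  -- there are no variables, so everything has degree zero and `inclLoc` is bijective.
  · have hs : Function.Surjective (inclLoc.{u} 0) := by
      have h0 (f : MvPolynomial (Fin 0 × Fin 0) (ULift.{u} ℤ)) :
          f ∈ MvPolynomial.homogeneousSubmodule (Fin 0 × Fin 0) (ULift.{u} ℤ) 0 := by
        obtain ⟨c, rfl⟩ := MvPolynomial.C_surjective (Fin 0 × Fin 0) f
        exact MvPolynomial.isHomogeneous_C _ _
      intro y
      obtain ⟨f, s, rfl⟩ := IsLocalization.exists_mk'_eq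
        (Submonoid.powers (genericMatrix.{u} 0).det) y
      refine ⟨HomogeneousLocalization.mk ⟨0, ⟨f, h0 f⟩, ⟨s, h0 s⟩, s.2⟩, ?_⟩
      exact (HomogeneousLocalization.val_mk _).trans (Localization.mk_eq_mk'_apply _ _)
    have h1 := range_comap_of_surjective _ _ hs
    rw [(RingHom.injective_iff_ker_eq_bot _).mp inclLoc_injective] at h1
    have h2 : q ∈ PrimeSpectrum.zeroLocus ((⊥ : Ideal (PGLRing.{u} 0)) : Set (PGLRing.{u} 0)) :=
      bot_le (a := q.asIdeal)
    rwa [← h1] at h2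
  · obtain ⟨x, rfl⟩ := ProjIsoSpecTopComponent.toSpec_surjective _ (det_mem.{u} (n := n)) hn q
    have : x.val.asHomogeneousIdeal.toIdeal.IsPrime := x.val.isPrime
    refine ⟨⟨x.val.asHomogeneousIdeal.toIdeal.map
      (algebraMap (MvPolynomial (Fin n × Fin n) (ULift.{u} ℤ))
      (Localization.Away (genericMatrix.{u} n).det)), ?_⟩, rfl⟩
    exact IsLocalization.isPrime_of_isPrime_disjoint
      (Submonoid.powers (genericMatrix.{u} n).det) _ _ inferInstance
      ((Ideal.disjoint_powers_iff_notMem_of_isPrime _).mpr x.2)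

instance : Surjective (glToPGL.{u} n) := ⟨comap_inclLoc_surjective n⟩

instance (S : Scheme.{u}) : Surjective (glOverToPGLOver.{u} n S) :=
  MorphismProperty.pullbackLift_fst_snd (P := @Surjective) (terminal.from S)
    (terminal.hom_ext _ _) (inferInstanceAs (Surjective (glToPGL.{u} n)))

end Surjectivity

/-! ### Finiteness of `GL_n` and `Mold_{n,d}` over `ℤ`. -/

section Finiteness

variable (n d : ℕ)

lemma specMap_comp_terminalFrom {R R' : CommRingCat.{u}} (φ : R ⟶ R') :
    Spec.map φ ≫ terminal.from (Spec R) = terminal.from (Spec R') := terminal.hom_ext _ _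

instance : IsIso (terminal.from (Spec (CommRingCat.of (ULift.{u} ℤ)))) :=
  isIso_of_isTerminal specULiftZIsTerminal terminalIsTerminal _

instance (σ : Fin d → Fin n × Fin n) :
    LocallyOfFiniteType (terminal.from (Spec (CommRingCat.of (ChartRing.{u} σ)))) := by
  rw [← specMap_comp_terminalFrom (CommRingCat.ofHom ((chartMk.{u} σ).comp MvPolynomial.C))]
  have : LocallyOfFiniteType
      (Spec.map (CommRingCat.ofHom ((chartMk.{u} σ).comp MvPolynomial.C))) := by
    rw [HasRingHomProperty.Spec_iff (P := @LocallyOfFiniteType.{u})]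
    have h1 : (chartMk.{u} σ).FiniteType :=
      RingHom.FiniteType.of_surjective _ Ideal.Quotient.mk_surjective
    have h2 : (algebraMap (ULift.{u} ℤ)
        (MvPolynomial (Fin d × Fin n × Fin n) (ULift.{u} ℤ))).FiniteType :=
      RingHom.finiteType_algebraMap.mpr inferInstance
    exact h1.comp h2
  infer_instance

instance : LocallyOfFinitePresentation (terminal.from (glScheme.{u} n)) := by
  rw [glScheme, ← specMap_comp_terminalFrom (CommRingCat.ofHom
    ((algebraMap (MvPolynomial (Fin n × Fin n) (ULift.{u} ℤ))
      (Localization.Away (genericMatrix.{u} n).det)).comp MvPolynomial.C))]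
  have : LocallyOfFinitePresentation (Spec.map (CommRingCat.ofHom
      ((algebraMap (MvPolynomial (Fin n × Fin n) (ULift.{u} ℤ))
      (Localization.Away (genericMatrix.{u} n).det)).comp MvPolynomial.C))) := by
    rw [LocallyOfFinitePresentation.SpecMap_iff]
    refine RingHom.FinitePresentation.comp ?_ ?_
    · exact RingHom.finitePresentation_algebraMap.mpr
        (IsLocalization.Away.finitePresentation (genericMatrix.{u} n).det)
    · exact RingHom.finitePresentation_algebraMap.mpr
        (inferInstanceAs (Algebra.FinitePresentation (ULift.{u} ℤ)
        (MvPolynomial (Fin n × Fin n) (ULift.{u} ℤ))))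
  infer_instance

instance : LocallyOfFiniteType (terminal.from (moldScheme.{u} n d)) := by
  have : IsZariskiLocalAtSource @LocallyOfFiniteType.{u} :=
    HasRingHomProperty.instIsZariskiLocalAtSource
  refine IsZariskiLocalAtSource.of_iSup_eq_top (P := @LocallyOfFiniteType.{u})
    (fun σ : Fin d → Fin n × Fin n => frameLocus σ (univMold.{u} n d)) ?_ fun σ => ?_
  · rw [eq_top_iff]
    intro t _
    rw [TopologicalSpace.Opens.mem_iSup]
    exact exists_mem_frameLocus _ t
  · let ι := (frameLocus σ (univMold.{u} n d)).ι
    obtain ⟨g, hg⟩ := exists_chart_hom (σ := σ) ((univMold.{u} n d).pullback ι) (fun t => by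
      rw [← mem_frameLocus, mem_frameLocus_pullback]
      exact t.2)
    -- The frame locus maps to the chart by `g`, and composing with `classify (chartMold σ)` gives
    -- back the open immersion `ι`. By cancellation `g` is locally of finite type, and so is the
    -- frame locus, since the chart is. No identification of the locus with the chart is needed.
    have h1 : g ≫ classify (chartMold.{u} σ) = ι := by
      rw [comp_classify, hg, classify_pullback_univMold]
    have : LocallyOfFiniteType (g ≫ classify (chartMold.{u} σ)) := by
      rw [h1]
      infer_instance
    have := locallyOfFiniteType_of_comp g (classify (chartMold.{u} σ))
    have h2 : ι ≫ terminal.from _ = g ≫ terminal.from _ := terminal.hom_ext _ _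
    change LocallyOfFiniteType (ι ≫ terminal.from _)
    rw [h2]
    infer_instance

end Finiteness

/-! ### Smoothness of `GL_{n,S} → Mold_{n,d} ⊗ S`. -/

section Smoothness

variable {n d : ℕ}

/-- Near a given point of the target both molds acquire frames, a rigid one for the pullback of `A`
and a normalized one for the universal mold. Lifting then gives formal smoothness, and finite
presentation follows by cancellation over `S`. -/
lemma smooth_glOverToPGLOver_orbitMap {S : Scheme.{u}} (A : Mold n d S)
    (hH1 : ∀ x : S, Subsingleton (HochschildH1 (S.residueField x) (A.fiber x)
      (QuotBimodule (A.fiber x)))) :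
    Smooth (glOverToPGLOver n S ≫ orbitMap A) := by
  rw [HasRingHomProperty.iff_exists_appLE (P := @Smooth)
    (RingHom.Smooth.stableUnderComposition.stableUnderCompositionWithLocalizationAway
      RingHom.Smooth.holdsForLocalizationAway).1]
  intro x
  let f : GLOver.{u} n S ⟶ MoldOver.{u} n d S := glOverToPGLOver n S ≫ orbitMap A
  let p : MoldOver.{u} n d S ⟶ S := pullback.snd _ _
  let q : MoldOver.{u} n d S ⟶ moldScheme.{u} n d := pullback.fst _ _
  obtain ⟨τ, W, hW, a, ha, hr⟩ := exists_isRigidFrame A (p (f x)) (hH1 _)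
  obtain ⟨σ, hσ⟩ := exists_mem_frameLocus (univMold.{u} n d) (q (f x))
  obtain ⟨W₀, hW₀, hxW₀, hle₀⟩ := exists_isAffineOpen_mem_and_subset hW
  -- `U` is small enough that every `t` landing in it pulls back a rigid frame of `A` from `W` and
  -- meets only the locus where the universal mold has a frame at `σ`.
  obtain ⟨U, hU, hxU, hleU⟩ := exists_isAffineOpen_mem_and_subset
    (show f x ∈ p ⁻¹ᵁ W₀ ⊓ q ⁻¹ᵁ frameLocus σ (univMold.{u} n d) from ⟨hxW₀, hσ⟩)
  obtain ⟨V, hV, hxV, hleV⟩ := exists_isAffineOpen_mem_and_subset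
    (show x ∈ f ⁻¹ᵁ U from hxU)
  refine ⟨⟨U, hU⟩, ⟨V, hV⟩, hxV, hleV, ?_⟩
  rw [RingHom.smooth_def]
  constructor
  · refine formallySmooth_appLE f hU hV hleV fun R R' φ hφ hI t z ht hz => ?_
    have hΓ : (Spec.map φ).appTop = (Scheme.ΓSpecIso R).hom ≫ φ ≫ (Scheme.ΓSpecIso R').inv := by
      rw [← Scheme.ΓSpecIso_naturality_assoc, Iso.hom_inv_id, Category.comp_id]
    have hiso (R : CommRingCat.{u}) : Function.Bijective (Scheme.ΓSpecIso R).hom :=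
      ConcreteCategory.bijective_of_isIso _
    have hiso' (R : CommRingCat.{u}) : Function.Bijective (Scheme.ΓSpecIso R).inv :=
      ConcreteCategory.bijective_of_isIso _
    have hsurj : Function.Surjective (Spec.map φ).appTop.hom := by
      rw [hΓ]
      exact ((hiso' R').2.comp hφ).comp (hiso R).2
    have hker (r : Γ(Spec R, ⊤)) (h : (Spec.map φ).appTop.hom r = 0) :
        φ ((Scheme.ΓSpecIso R).hom r) = 0 := by
      rw [hΓ] at h
      exact (hiso' R').1 (h.trans (map_zero _).symm)
    have hsq (r s : Γ(Spec R, ⊤)) (h : (Spec.map φ).appTop.hom r = 0)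
        (h' : (Spec.map φ).appTop.hom s = 0) : r * s = 0 := by
      apply (hiso R).1
      have := hI _ _ (hker r h) (hker s h')
      exact (map_mul (Scheme.ΓSpecIso R).hom.hom r s).trans (this.trans (map_zero _).symm)
    have htW : ⊤ ≤ (t ≫ p) ⁻¹ᵁ W := fun y _ => hle₀ (hleU (ht y)).1
    obtain ⟨b, hb⟩ := exists_isFrameOn_top (σ := σ) ((univMold.{u} n d).pullback (t ≫ q))
      fun y => (mem_frameLocus_pullback (t ≫ q) (univMold.{u} n d) y).mpr (hleU (ht y)).2
    -- `hr.map` transports the homotopy along the ring map from sections over `W` to functions on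
    -- `Spec R`, so rigidity needs no new argument there.
    exact exists_lift_orbitMap A (Spec.map φ) hsurj hsq t z hz (ha.pullback (t ≫ p) ⊤ htW)
      (hr.map _) hb
  · have hfp : f ≫ p = pullback.snd _ _ := by
      simp only [f, p, Category.assoc, orbitMap, glOverToPGLOver, pullback.lift_snd]
    have e₁ : U ≤ p ⁻¹ᵁ W₀ := fun y hy => (hleU hy).1
    have e₂ : V ≤ f ⁻¹ᵁ U := hleV
    have h1 : p.appLE W₀ U e₁ ≫ f.appLE U V e₂ =
        (f ≫ p).appLE W₀ V (e₂.trans fun y hy => e₁ hy) :=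
      Scheme.Hom.appLE_comp_appLE _ _ _ _ _ _ _
    have : LocallyOfFinitePresentation (f ≫ p) := by
      rw [hfp]
      infer_instance
    -- `f ≫ p` is the projection `GL_{n,S} → S`, of finite presentation, and `p` is of finite type
    -- because `Mold_{n,d}` is; together they make `f` of finite presentation.
    refine RingHom.FinitePresentation.of_comp_finiteType (p.appLE W₀ U e₁).hom ?_
      (LocallyOfFiniteType.finiteType_appLE p hW₀ hU e₁)
    rw [← CommRingCat.hom_comp, h1]
    exact LocallyOfFinitePresentation.finitePresentation_appLE (f ≫ p) hW₀ hV _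

end Smoothness

end Moduli

/-- If `H¹(𝒜(x), M_n(k(x))/𝒜(x)) = 0` for all points `x` of `S`, then the `PGL_{n,S}`-orbit of the
mold `𝒜`, that is, the image of `φ_𝒜 : PGL_{n,S} ⟶ Mold_{n,d} ⊗_ℤ S`, is open. -/
theorem theorem1p3 (n d : ℕ) (S : AlgebraicGeometry.Scheme.{u})
    [AlgebraicGeometry.IsLocallyNoetherian S] (A : Moduli.Mold n d S)
    (hH1 : ∀ x : S, Subsingleton (Moduli.HochschildH1 (S.residueField x) (A.fiber x)
      (Moduli.QuotBimodule (A.fiber x)))) :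
    IsOpen (Set.range (Moduli.orbitMap A)) := by
  have := Moduli.smooth_glOverToPGLOver_orbitMap A hH1
  -- Smooth morphisms are open; precomposing `orbitMap A` with a surjection does not change its
  -- image.
  have h := (Moduli.glOverToPGLOver n S ≫ Moduli.orbitMap A).isOpenMap.isOpen_range
  have hcomp : ⇑(Moduli.glOverToPGLOver n S ≫ Moduli.orbitMap A) =
      Moduli.orbitMap A ∘ Moduli.glOverToPGLOver n S :=
    funext fun x => Scheme.Hom.comp_apply _ _ x
  rwa [hcomp, (Moduli.glOverToPGLOver n S).surjective.range_comp] at h
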